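/- Theorem. A segment is given by its two distinct endpoints in $\mathbb{R}^2$ (it may be horizontal or vertical, and different segments may share endpoints or coordinates). A 3-rectangle is a closed region $[a,b]\times(-\infty,c]$ with $a\le b$, i.e. a (possibly degenerate) axis-parallel rectangle without lower side ("bottomless rectangle"). A region stabs a family $S$ of segments if it contains exactly one endpoint of each segment of $S$. Two regions are combinatorially equivalent if they contain the same endpoints of segments of $S$, and combinatorially different otherwise. A stabbing 3-rectangle is represented by (the numbers of) three not necessarily distinct segment endpoints that lie in it, one on its left side, one on its right side and one on its top side. All combinatorially different stabbing 3-rectangles of a family $S$ of $n$ segments can be computed in $O(n\log n)$ time. That is, there is one random access machine program which, on the input of any $n\ge 1$ segments $S$ (the number $n$ and the real coordinates of the $2n$ endpoints), halts after at most $T(n)$ steps, where $T(n)=O(n\log n)$ as $n\to\infty$, and outputs a list of representations of stabbing 3-rectangles of $S$ that contains exactly one member of every combinatorial equivalence class of stabbing 3-rectangles of $S$. The machine model: programs are built from assignments, sequencing, conditionals and while loops, over finitely many zero-initialised arrays of natural numbers and finitely many zero-initialised arrays of real numbers, indexed by computed natural numbers. Constants, array accesses, the integer operations $+$, $-$ (truncated),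 $\cdot$ and $/$ (rounded down), comparisons and assignments cost one step each. Real numbers can only be copied and compared. Every natural number that the program stores must be less than $(n+1)^k$ for a constant $k$ (words of $O(\log n)$ bits). -/

import Mathlib

/-! ### A random access machine with real cells

A program owns finitely many named, zero-initialised infinite arrays of natural numbers and finitely
many named infinite arrays of real numbers (a scalar variable is a cell of an array).  Every
operation has unit cost.  Reals can only be copied and compared, and there is no conversion
between reals and integers.  The semantics carries a word bound `W`: a program that tries to store
a natural number `≥ W` is stuck. -/

namespace RealRAM

/-- The memory: `nat a i` is cell `i` of integer array `a`, and `real a i` is cell `i` of real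
array `a`. -/
structure Memory where
  nat : ℕ → ℕ → ℕ
  real : ℕ → ℕ → ℝ

/-- Integer expressions.  An array name is a constant of the program, an index is computed. -/
inductive NExp : Type where
  | const (c : ℕ)
  | read (a : ℕ) (i : NExp)
  | add (e f : NExp)
  | sub (e f : NExp)
  | mul (e f : NExp)
  | div (e f : NExp)

namespace NExp

/-- Value of an integer expression (`sub` is truncated, `div` rounds down, with `x / 0 = 0`). -/
def eval (m : Memory) : NExp → ℕ
  | const c => c
  | read a i => m.nat a (i.eval m)
  | add e f => e.eval m + f.eval m
  | sub e f => e.eval m - f.eval m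
  | mul e f => e.eval m * f.eval m
  | div e f => e.eval m / f.eval m

/-- Cost of evaluating an integer expression: one step per constant, access or operation. -/
def cost : NExp → ℕ
  | const _ => 1
  | read _ i => i.cost + 1
  | add e f => e.cost + f.cost + 1
  | sub e f => e.cost + f.cost + 1
  | mul e f => e.cost + f.cost + 1
  | div e f => e.cost + f.cost + 1

end NExp

/-- Tests. `realLE a i b j` compares cell `i` of real array `a` with cell `j` of real array `b`. -/
inductive Test : Type where
  | natLE (e f : NExp)
  | realLE (a : ℕ) (i : NExp) (b : ℕ) (j : NExp)
  | not (t : Test)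
  | and (t u : Test)

namespace Test

/-- Truth of a test. -/
def Holds (m : Memory) : Test → Prop
  | natLE e f => e.eval m ≤ f.eval m
  | realLE a i b j => m.real a (i.eval m) ≤ m.real b (j.eval m)
  | not t => ¬ t.Holds m
  | and t u => t.Holds m ∧ u.Holds m

/-- Cost of a test (both sides of a conjunction are always evaluated). -/
def cost : Test → ℕ
  | natLE e f => e.cost + f.cost + 1
  | realLE _ i _ j => i.cost + j.cost + 3
  | not t => t.cost + 1
  | and t u => t.cost + u.cost + 1

end Test

/-- Programs.  `store a i e` stores `e` in cell `i` of integer array `a`; `copy a i b j` copies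
cell `j` of real array `b` into cell `i` of real array `a`. -/
inductive Program : Type where
  | skip
  | store (a : ℕ) (i e : NExp)
  | copy (a : ℕ) (i : NExp) (b : ℕ) (j : NExp)
  | seq (c d : Program)
  | branch (t : Test) (c d : Program)
  | loop (t : Test) (c : Program)

/-- Overwrite one integer cell. -/
def Memory.setNat (m : Memory) (a i v : ℕ) : Memory where
  nat := Function.update m.nat a (Function.update (m.nat a) i v)
  real := m.real

/-- Overwrite one real cell. -/
def Memory.setReal (m : Memory) (a i : ℕ) (v : ℝ) : Memory where
  nat := m.nat
  real := Function.update m.real a (Function.update (m.real a) i v)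

/-- `Exec W c m m' t`: with word bound `W`, program `c` started in memory `m` halts in memory `m'`
after exactly `t` steps. -/
inductive Exec (W : ℕ) : Program → Memory → Memory → ℕ → Prop where
  | skip (m : Memory) : Exec W .skip m m 1
  | store (m : Memory) (a : ℕ) (i e : NExp) (h : e.eval m < W) :
      Exec W (.store a i e) m (m.setNat a (i.eval m) (e.eval m)) (i.cost + e.cost + 1)
  | copy (m : Memory) (a : ℕ) (i : NExp) (b : ℕ) (j : NExp) :
      Exec W (.copy a i b j) m (m.setReal a (i.eval m) (m.real b (j.eval m)))
        (i.cost + j.cost + 2)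
  | seq {c d : Program} {m₁ m₂ m₃ : Memory} {t u : ℕ}
      (hc : Exec W c m₁ m₂ t) (hd : Exec W d m₂ m₃ u) :
      Exec W (.seq c d) m₁ m₃ (t + u)
  | branchTrue {b : Test} {c d : Program} {m m' : Memory} {t : ℕ}
      (hb : b.Holds m) (hc : Exec W c m m' t) :
      Exec W (.branch b c d) m m' (b.cost + t + 1)
  | branchFalse {b : Test} {c d : Program} {m m' : Memory} {t : ℕ}
      (hb : ¬ b.Holds m) (hd : Exec W d m m' t) :
      Exec W (.branch b c d) m m' (b.cost + t + 1)
  | loopDone {b : Test} {c : Program} {m : Memory} (hb : ¬ b.Holds m) :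
      Exec W (.loop b c) m m (b.cost + 1)
  | loopStep {b : Test} {c : Program} {m₁ m₂ m₃ : Memory} {t u : ℕ}
      (hb : b.Holds m₁) (hc : Exec W c m₁ m₂ t) (hl : Exec W (.loop b c) m₂ m₃ u) :
      Exec W (.loop b c) m₁ m₃ (b.cost + t + u + 1)

end RealRAM

/-! ### Stabbing 3-rectangles -/

namespace Stabbing

/-- A segment of nonzero length in the plane, given by its two endpoints. -/
structure Segment where
  p : ℝ × ℝ
  q : ℝ × ℝ
  ne : p ≠ q

/-- The region `R` contains exactly one endpoint of each segment. -/
def Stabs {n : ℕ} (R : Set (ℝ × ℝ)) (S : Fin n → Segment) : Prop :=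
  ∀ i, ((S i).p ∈ R ∧ (S i).q ∉ R) ∨ ((S i).p ∉ R ∧ (S i).q ∈ R)

/-- The set of all endpoints of the segments. -/
def endpoints {n : ℕ} (S : Fin n → Segment) : Set (ℝ × ℝ) :=
  {z | ∃ i, z = (S i).p ∨ z = (S i).q}

/-- Two regions are combinatorially equivalent if they contain the same segment endpoints. -/
def CombEquiv {n : ℕ} (S : Fin n → Segment) (R R' : Set (ℝ × ℝ)) : Prop :=
  R ∩ endpoints S = R' ∩ endpoints S

/-- The closed bottomless rectangle with left side `x = a`, right side `x = b`, top side `y = c`. -/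
def bottomless (a b c : ℝ) : Set (ℝ × ℝ) :=
  {z | a ≤ z.1 ∧ z.1 ≤ b ∧ z.2 ≤ c}

/-- A 3-rectangle: a (possibly degenerate) closed axis-parallel rectangle without lower side. -/
def IsThreeRectangle (R : Set (ℝ × ℝ)) : Prop :=
  ∃ a b c : ℝ, a ≤ b ∧ R = bottomless a b c

/-- The endpoints numbered `0, …, 2n - 1`: segment `i` has endpoints number `2i` and `2i + 1`. -/
def endpt {n : ℕ} (S : Fin n → Segment) (e : Fin (2 * n)) : ℝ × ℝ :=
  if e.val % 2 = 0 then (S ⟨e.val / 2, by omega⟩).p else (S ⟨e.val / 2, by omega⟩).q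

/-- The description of a 3-rectangle by (the numbers of) one endpoint on each of its sides. -/
structure Description (n : ℕ) where
  left : Fin (2 * n)
  right : Fin (2 * n)
  top : Fin (2 * n)

/-- The 3-rectangle given by a description. -/
def Description.region {n : ℕ} (S : Fin n → Segment) (d : Description n) : Set (ℝ × ℝ) :=
  bottomless (endpt S d.left).1 (endpt S d.right).1 (endpt S d.top).2

/-- The describing endpoints belong to the described region (hence lie on its boundary). -/
def Description.Valid {n : ℕ} (S : Fin n → Segment) (d : Description n) : Prop :=
  endpt S d.left ∈ d.region S ∧ endpt S d.right ∈ d.region S ∧ endpt S d.top ∈ d.region S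

/-- `L` lists all combinatorially different stabbing 3-rectangles of `S`, each exactly once up to
combinatorial equivalence. -/
structure ListsAllStabbers {n : ℕ} (S : Fin n → Segment) (L : List (Description n)) : Prop where
  valid : ∀ d ∈ L, d.Valid S
  stabs : ∀ d ∈ L, Stabs (d.region S) S
  different : L.Pairwise fun d d' => ¬ CombEquiv S (d.region S) (d'.region S)
  complete : ∀ R, IsThreeRectangle R → Stabs R S → ∃ d ∈ L, CombEquiv S R (d.region S)

/-- The initial memory on input `S`: integer array `0` holds `n` in cell `0`, real arrays `0` and
`1` hold the `x`- and `y`-coordinates of the `2n` endpoints, all other cells are zero. -/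
noncomputable def initialMemory {n : ℕ} (S : Fin n → Segment) : RealRAM.Memory where
  nat := fun a i => if a = 0 ∧ i = 0 then n else 0
  real := fun a i =>
    if h : i < 2 * n then
      if a = 0 then (endpt S ⟨i, h⟩).1 else if a = 1 then (endpt S ⟨i, h⟩).2 else 0
    else 0

/-- The memory `m` holds the output `L`: the length of `L` is in cell `0` of integer array `0`, and
integer arrays `1`, `2`, `3` hold the left, right and top endpoint numbers of its members. -/
def Outputs {n : ℕ} (m : RealRAM.Memory) (L : List (Description n)) : Prop :=
  m.nat 0 0 = L.length ∧
    ∀ (j : ℕ) (hj : j < L.length),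
      m.nat 1 j = (L[j].left : ℕ) ∧ m.nat 2 j = (L[j].right : ℕ) ∧ m.nat 3 j = (L[j].top : ℕ)

end Stabbing

/-! Sort the endpoints lexicographically by `(x, y)` and by `(y, x)`. In rank space the points are
in general position, and a rectangle is given by the ranks `a`, `b`, `c` of the points on its left,
right and top side.

A stabbing rectangle contains an endpoint of every segment, and it contains every endpoint whose
mate lies to the left of `a`; hence `c` is at least the largest height `topOf a` forced by these two
conditions. The mate of the point on the top side lies outside of the rectangle: to its left, to its
right, or above it. If it lies to the left or above, then one of the two conditions says that `c` is
at most `topOf a`. If it lies to the right, the same holds after a reflection that exchanges left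
and right. Once `a` and `c` are known, the same argument for the right side, whose point has its
mate to the left, above, or further to the right, leaves a single candidate for `b`. So there are at
most `4 n` candidates, `2 n` for each orientation.

All candidates are tested in one sweep per orientation, which moves the sides of a box one point at
a time and counts the segments that the box splits. As `a` increases, `topOf a` increases as well,
and the candidate for `b` is the maximum of an increasing and a decreasing function of `a`. Hence
the sides move only `O(n)` times in total.

If coordinates coincide, several rectangles in rank space may have the same sides in the plane. The
ones that contain exactly the endpoints in the closed region spanned by their sides represent every
combinatorial class once, and for this property it suffices to look at the three points next to the
box in the two orders. -/

namespace RealRAM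

/-! ### Program logic -/

theorem Memory.nat_setNat (m : Memory) (a i v b j : ℕ) :
    (m.setNat a i v).nat b j = if b = a ∧ j = i then v else m.nat b j := by
  by_cases hb : b = a
  · subst hb
    by_cases hj : j = i <;> simp [Memory.setNat, hj]
  · simp [Memory.setNat, hb]

@[simp] theorem Memory.nat_setNat_self (m : Memory) (a i v : ℕ) :
    (m.setNat a i v).nat a = Function.update (m.nat a) i v := by
  simp [Memory.setNat]

@[simp] theorem Memory.nat_setNat_of_ne (m : Memory) (a i v b : ℕ) (h : b ≠ a) :
    (m.setNat a i v).nat b = m.nat b := by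
  simp [Memory.setNat, h]

@[simp] theorem Memory.real_setNat (m : Memory) (a i v : ℕ) : (m.setNat a i v).real = m.real :=
  rfl

namespace Program

/-- Worst-case cost of a loop-free program (loops count as `0`). -/
def time : Program → ℕ
  | skip => 1
  | store _ i e => i.cost + e.cost + 1
  | copy _ i _ j => i.cost + j.cost + 2
  | seq c d => c.time + d.time
  | branch t c d => t.cost + max c.time d.time + 1
  | loop _ _ => 0

/-- The integer arrays a program may write to. -/
def writes : Program → List ℕ
  | skip => []
  | store a _ _ => [a]
  | copy _ _ _ _ => []
  | seq c d => c.writes ++ d.writes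
  | branch _ c d => c.writes ++ d.writes
  | loop _ c => c.writes

/-- A program that never writes to real arrays. -/
def NatOnly : Program → Prop
  | skip => True
  | store _ _ _ => True
  | copy _ _ _ _ => False
  | seq c d => c.NatOnly ∧ d.NatOnly
  | branch _ c d => c.NatOnly ∧ d.NatOnly
  | loop _ c => c.NatOnly

/-- Weakest precondition of a loop-free program that does not write to real arrays; it is `False`
for all other programs. -/
def wp (W : ℕ) : Program → (Memory → Prop) → Memory → Prop
  | skip, Q, m => Q m
  | store a i e, Q, m => e.eval m < W ∧ Q (m.setNat a (i.eval m) (e.eval m))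
  | copy _ _ _ _, _, _ => False
  | seq c d, Q, m => c.wp W (d.wp W Q) m
  | branch t c d, Q, m => (t.Holds m → c.wp W Q m) ∧ (¬ t.Holds m → d.wp W Q m)
  | loop _ _, _, _ => False

theorem exists_exec_of_wp {W : ℕ} {c : Program} {m : Memory} {Q : Memory → Prop}
    (h : c.wp W Q m) : ∃ m' t, Exec W c m m' t ∧ t ≤ c.time ∧ Q m' := by
  induction c generalizing m Q with
  | skip => exact ⟨m, 1, .skip m, le_rfl, h⟩
  | store a i e => exact ⟨_, _, .store m a i e h.1, le_rfl, h.2⟩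
  | copy => exact h.elim
  | seq c d ihc ihd =>
    obtain ⟨m₁, t, hc, ht, hQ⟩ := ihc h
    obtain ⟨m₂, u, hd, hu, hR⟩ := ihd hQ
    exact ⟨m₂, t + u, .seq hc hd, Nat.add_le_add ht hu, hR⟩
  | branch b c d ihc ihd =>
    by_cases hb : b.Holds m
    · obtain ⟨m₁, t, hc, ht, hQ⟩ := ihc (h.1 hb)
      exact ⟨m₁, _, .branchTrue hb hc, by simp only [Program.time]; omega, hQ⟩
    · obtain ⟨m₁, t, hd, ht, hQ⟩ := ihd (h.2 hb)
      exact ⟨m₁, _, .branchFalse hb hd, by simp only [Program.time]; omega, hQ⟩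
  | loop => exact h.elim

end Program

/-- `m'` agrees with `m` on the real arrays and on all integer arrays outside the list `l`. -/
structure Frame (l : List ℕ) (m m' : Memory) : Prop where
  real : m'.real = m.real
  nat : ∀ a ∉ l, m'.nat a = m.nat a

theorem Frame.refl (l : List ℕ) (m : Memory) : Frame l m m := ⟨rfl, fun _ _ => rfl⟩

theorem Frame.trans {l : List ℕ} {m₁ m₂ m₃ : Memory} (h : Frame l m₁ m₂) (h' : Frame l m₂ m₃) :
    Frame l m₁ m₃ :=
  ⟨h'.real.trans h.real, fun a ha => (h'.nat a ha).trans (h.nat a ha)⟩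

theorem Frame.mono {l l' : List ℕ} {m m' : Memory} (h : Frame l m m') (hl : l ⊆ l') :
    Frame l' m m' :=
  ⟨h.real, fun a ha => h.nat a fun h' => ha (hl h')⟩

theorem Frame.setNat {l : List ℕ} {a : ℕ} (m : Memory) (i v : ℕ) (ha : a ∈ l) :
    Frame l m (m.setNat a i v) :=
  ⟨rfl, fun _ hb => m.nat_setNat_of_ne a i v _ fun h => hb (h ▸ ha)⟩

theorem Frame.setNat_setNat {l : List ℕ} {m m' : Memory} (h : Frame l m m') (a i v : ℕ) :
    Frame l (m.setNat a i v) (m'.setNat a i v) := by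
  refine ⟨h.real, fun b hb => ?_⟩
  obtain rfl | hba := eq_or_ne b a
  · rw [Memory.nat_setNat_self, Memory.nat_setNat_self, h.nat b hb]
  · rw [Memory.nat_setNat_of_ne _ _ _ _ _ hba, Memory.nat_setNat_of_ne _ _ _ _ _ hba, h.nat b hb]

theorem Exec.frame {W : ℕ} {c : Program} {m m' : Memory} {t : ℕ} (h : Exec W c m m' t)
    (hc : c.NatOnly) : Frame c.writes m m' := by
  induction h with
  | skip m => exact .refl _ _
  | store m a i e _ => exact .setNat _ _ _ (by simp [Program.writes])
  | copy => exact hc.elim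
  | seq _ _ ihc ihd =>
    exact ((ihc hc.1).mono (by simp [Program.writes])).trans
      ((ihd hc.2).mono (by simp [Program.writes]))
  | branchTrue _ _ ih => exact (ih hc.1).mono (by simp [Program.writes])
  | branchFalse _ _ ih => exact (ih hc.2).mono (by simp [Program.writes])
  | loopDone => exact .refl _ _
  | loopStep _ _ _ ihc ihl => exact (ihc hc).trans (ihl hc)

/-- With word bound `W`, the program `c` started in `m` halts within `T` steps in a memory that
satisfies `Q` and differs from `m` only in the integer arrays that `c` writes to. -/
def Runs (W : ℕ) (c : Program) (m : Memory) (T : ℕ) (Q : Memory → Prop) : Prop :=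
  ∃ m' t, Exec W c m m' t ∧ t ≤ T ∧ Frame c.writes m m' ∧ Q m'

/-- The scalar variable stored in cell `0` of integer array `a`. -/
abbrev var (a : ℕ) : NExp := .read a (.const 0)

/-- Assignment to the scalar variable stored in cell `0` of integer array `a`. -/
abbrev assign (a : ℕ) (e : NExp) : Program := .store a (.const 0) e

/-- The strict comparison `e < f` of two integer expressions. -/
abbrev ltTest (e f : NExp) : Test := .natLE (.add e (.const 1)) f

/-- Run `c` with the variable `k` taking the values `0, 1, …` below the value of the variable
`b`. -/
def forLoop (k b : ℕ) (c : Program) : Program :=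
  .seq (assign k (.const 0))
    (.loop (ltTest (var k) (var b)) (.seq c (assign k (.add (var k) (.const 1)))))

namespace Runs

variable {W T U V : ℕ} {c d : Program} {m : Memory} {Q R : Memory → Prop}

theorem mono (h : Runs W c m T Q) (hT : T ≤ U)
    (hQ : ∀ m', Frame c.writes m m' → Q m' → R m') : Runs W c m U R := by
  obtain ⟨m', t, hc, ht, hm, hQ'⟩ := h
  exact ⟨m', t, hc, ht.trans hT, hm, hQ m' hm hQ'⟩

theorem seq (hc : Runs W c m T Q) (hd : ∀ m', Frame c.writes m m' → Q m' → Runs W d m' U R)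
    (hV : T + U ≤ V) : Runs W (.seq c d) m V R := by
  obtain ⟨m₁, t, hc, ht, hm₁, hQ⟩ := hc
  obtain ⟨m₂, u, hd, hu, hm₂, hR⟩ := hd m₁ hm₁ hQ
  exact ⟨m₂, t + u, .seq hc hd, by omega, (hm₁.mono (by simp [Program.writes])).trans
    (hm₂.mono (by simp [Program.writes])), hR⟩

theorem branch {b : Test} (hc : b.Holds m → Runs W c m T Q) (hd : ¬ b.Holds m → Runs W d m T Q)
    (hU : b.cost + T + 1 ≤ U) : Runs W (.branch b c d) m U Q := by
  by_cases hb : b.Holds m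
  · obtain ⟨m', t, hc, ht, hm, hQ⟩ := hc hb
    exact ⟨m', _, .branchTrue hb hc, by omega, hm.mono (by simp [Program.writes]), hQ⟩
  · obtain ⟨m', t, hd, ht, hm, hQ⟩ := hd hb
    exact ⟨m', _, .branchFalse hb hd, by omega, hm.mono (by simp [Program.writes]), hQ⟩

theorem of_wp (hc : c.NatOnly) (hT : c.time ≤ T) (h : c.wp W Q m) : Runs W c m T Q := by
  obtain ⟨m', t, he, ht, hQ⟩ := Program.exists_exec_of_wp h
  exact ⟨m', t, he, ht.trans hT, he.frame hc, hQ⟩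

theorem assign_seq {a : ℕ} {e : NExp} (he : e.eval m < W)
    (hd : Runs W d (m.setNat a 0 (e.eval m)) T Q) (hU : e.cost + 2 + T ≤ U) :
    Runs W (.seq (assign a e) d) m U Q :=
  .seq (T := e.cost + 2) (Q := fun m' => m' = m.setNat a 0 (e.eval m))
    (.of_wp trivial (by simp only [Program.time, NExp.cost]; omega) ⟨he, rfl⟩)
    (fun _ _ hm => hm ▸ hd) hU

theorem loop {b : Test} (I : Memory → Prop) (μ : Memory → ℕ) (hI : I m)
    (hstep : ∀ m', Frame c.writes m m' → I m' → b.Holds m' →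
      Runs W c m' T fun m'' => I m'' ∧ μ m'' < μ m')
    (hU : μ m * (T + b.cost + 1) + b.cost + 1 ≤ U) :
    Runs W (.loop b c) m U fun m' => I m' ∧ ¬ b.Holds m' := by
  suffices H : ∀ k m', μ m' = k → Frame c.writes m m' → I m' →
      ∃ m'' t, Exec W (.loop b c) m' m'' t ∧ t ≤ k * (T + b.cost + 1) + b.cost + 1 ∧
        Frame c.writes m m'' ∧ I m'' ∧ ¬ b.Holds m'' by
    obtain ⟨m', t, hl, ht, hm⟩ := H _ m rfl (.refl _ _) hI
    exact ⟨m', t, hl, ht.trans hU, hm⟩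
  intro k
  induction k using Nat.strong_induction_on with
  | _ k ih =>
    intro m' hk hm hI
    by_cases hb : b.Holds m'
    · obtain ⟨m₁, t, hc, ht, hm₁, hI₁, hμ⟩ := hstep m' hm hI hb
      rw [hk] at hμ
      obtain ⟨m₂, u, hl, hu, hm₂⟩ := ih _ hμ m₁ rfl (hm.trans hm₁) hI₁
      refine ⟨m₂, _, .loopStep hb hc hl, ?_, hm₂⟩
      have := Nat.mul_le_mul_right (T + b.cost + 1) (Nat.succ_le_of_lt hμ)
      rw [Nat.succ_mul] at this
      omega
    · exact ⟨m', _, .loopDone hb, by omega, hm, hI, hb⟩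

theorem forLoop {k b N : ℕ} (I : ℕ → Memory → Prop)
    (hk : k ∉ c.writes) (hb : b ∉ k :: c.writes) (hN : m.nat b 0 = N) (hW : N < W)
    (hI : I 0 (m.setNat k 0 0))
    (hstep : ∀ i m', i < N → Frame (k :: c.writes) m m' → m'.nat k 0 = i → I i m' →
      Runs W c m' T fun m'' => I (i + 1) (m''.setNat k 0 (i + 1)))
    (hU : N * (T + 14) + 11 ≤ U) :
    Runs W (forLoop k b c) m U (I N) := by
  have hbound {m'} (hm : Frame (k :: c.writes) m m') : m'.nat b 0 = N := by rw [hm.nat b hb, hN]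
  have hm₀ : Frame (k :: c.writes) m (m.setNat k 0 0) := .setNat _ _ _ (by simp)
  have hsub : (Program.seq c (assign k (.add (var k) (.const 1)))).writes ⊆ k :: c.writes := by
    intro x; simp [Program.writes]; tauto
  refine assign_seq (T := N * (T + 14) + 8) (Nat.zero_lt_of_lt hW) ?_
    (by simp only [NExp.cost]; omega)
  refine (loop (T := T + 6) (U := N * (T + 14) + 8)
    (fun m' => m'.nat k 0 ≤ N ∧ I (m'.nat k 0) m') (fun m' => N - m'.nat k 0)
    (by simpa [NExp.eval] using hI) ?_ ?_).mono le_rfl ?_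
  · rintro m₁ hm₁ ⟨-, hI₁⟩ hlt
    have hlt : m₁.nat k 0 < N := by
      simpa [Test.Holds, NExp.eval, hbound (hm₀.trans (hm₁.mono hsub))] using hlt
    refine seq (hstep _ m₁ hlt (hm₀.trans (hm₁.mono hsub)) rfl hI₁) (fun m₂ hm₂ hI₂ => ?_) le_rfl
    have hk₂ : m₂.nat k 0 = m₁.nat k 0 := by rw [hm₂.nat k hk]
    refine .of_wp trivial (by simp [Program.time, NExp.cost]) ?_
    simp only [Program.wp, NExp.eval, hk₂]
    exact ⟨by omega, ⟨by simpa using hlt, by simpa using hI₂⟩, by simp; omega⟩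
  · simp only [Memory.nat_setNat_self, NExp.eval, Function.update_self, Nat.sub_zero, Test.cost,
      NExp.cost]
    exact le_of_eq (by ring)
  · rintro m₁ hm₁ ⟨⟨hle, hI₁⟩, hge⟩
    have hge : N ≤ m₁.nat k 0 := by
      simpa [Test.Holds, NExp.eval, hbound (hm₀.trans (hm₁.mono hsub))] using hge
    exact (le_antisymm hle hge) ▸ hI₁

theorem storeLoop {k b dst N : ℕ} {i e : NExp} {f g : ℕ → ℕ} (hdst : k ≠ dst)
    (hb : b ∉ [k, dst]) (hN : m.nat b 0 = N) (hW : N < W) (hg : Set.InjOn g (Set.Iio N))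
    (heval : ∀ p < N, ∀ m', Frame [k, dst] m m' → m'.nat k 0 = p →
      i.eval m' = g p ∧ e.eval m' = f p ∧ f p < W)
    (hT : N * (i.cost + e.cost + 15) + 11 ≤ T) :
    Runs W (RealRAM.forLoop k b (.store dst i e)) m T
      fun m' => ∀ p < N, m'.nat dst (g p) = f p := by
  refine forLoop (T := i.cost + e.cost + 1) (fun q m' => ∀ p < q, m'.nat dst (g p) = f p)
    (by simpa [Program.writes] using hdst) (by simpa [Program.writes] using hb) hN hW
    (by simp) (fun q m' hq hm' hk hI => ?_) hT
  obtain ⟨hi, he, hfW⟩ := heval q hq m' hm' hk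
  refine .of_wp trivial le_rfl ?_
  simp only [Program.wp, hi, he]
  refine ⟨hfW, fun p hp => ?_⟩
  rw [Memory.nat_setNat_of_ne _ _ _ _ _ hdst.symm, Memory.nat_setNat_self]
  obtain rfl | hpq := Nat.eq_or_lt_of_le (Nat.le_of_lt_succ hp)
  · rw [Function.update_self]
  · rw [Function.update_of_ne, hI p hpq]
    exact fun h => hpq.ne (hg (hpq.trans hq) hq h)

end Runs

/-! ### Merging blocks of a sequence -/

/-- The list of the values of `S` on `[i, j)`. -/
def slice (S : ℕ → ℕ) (i j : ℕ) : List ℕ := (List.range' i (j - i)).map S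

theorem mem_slice {S : ℕ → ℕ} {i j e : ℕ} : e ∈ slice S i j ↔ ∃ p, i ≤ p ∧ p < j ∧ S p = e := by
  simp only [slice, List.mem_map, List.mem_range'_1, and_assoc]
  exact exists_congr fun p => and_congr_right fun hi => and_congr_left' (by omega)

theorem slice_eq_nil (S : ℕ → ℕ) {i j : ℕ} (h : j ≤ i) : slice S i j = [] := by
  simp [slice, Nat.sub_eq_zero_of_le h]

theorem slice_eq_cons (S : ℕ → ℕ) {i j : ℕ} (h : i < j) :
    slice S i j = S i :: slice S (i + 1) j := by
  rw [slice, show j - i = j - (i + 1) + 1 by omega, List.range'_succ, List.map_cons, slice]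

theorem slice_append (S : ℕ → ℕ) {i j k : ℕ} (hij : i ≤ j) (hjk : j ≤ k) :
    slice S i j ++ slice S j k = slice S i k := by
  obtain ⟨u, rfl⟩ := Nat.exists_eq_add_of_le hij
  obtain ⟨v, rfl⟩ := Nat.exists_eq_add_of_le hjk
  rw [slice, slice, slice, ← List.map_append, Nat.add_sub_cancel_left, Nat.add_sub_cancel_left,
    Nat.add_assoc, Nat.add_sub_cancel_left, List.range'_append_1]

theorem slice_congr {S D : ℕ → ℕ} {i j : ℕ} (h : ∀ p, i ≤ p → p < j → S p = D p) :
    slice S i j = slice D i j :=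
  List.map_congr_left fun p hp => by
    rw [List.mem_range'_1] at hp
    exact h p hp.1 (by omega)

theorem slice_update_succ (D : ℕ → ℕ) {s k : ℕ} (v : ℕ) (h : s ≤ k) :
    slice (Function.update D k v) s (k + 1) = slice D s k ++ [v] := by
  rw [← slice_append _ h k.le_succ, slice_eq_cons _ k.lt_succ_self, slice_eq_nil _ le_rfl,
    Function.update_self]
  exact congrArg (· ++ [v]) (slice_congr fun p _ hp => Function.update_of_ne hp.ne _ _)

section Merge

variable {α : Type*} [LinearOrder α] (key : ℕ → α)

/-- The merge of the blocks `[s, s + w)` and `[s + w, s + 2w)` of `S`, both cut off at `N`. -/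
def mergedBlock (S : ℕ → ℕ) (w N s : ℕ) : List ℕ :=
  (slice S s (min (s + w) N)).merge (slice S (min (s + w) N) (min (s + 2 * w) N))
    fun e f => decide (key e ≤ key f)

/-- Every block `[s, s + w)` of `S` with `w ∣ s`, cut off at `N`, is sorted. -/
def BlockSorted (S : ℕ → ℕ) (w N : ℕ) : Prop :=
  ∀ s, w ∣ s → (slice S s (min (s + w) N)).Pairwise fun e f => key e ≤ key f

/-- The blocks of length `2w` of `D` that begin before `k` are the merged blocks of `S`. -/
def MergedBelow (S D : ℕ → ℕ) (w N k : ℕ) : Prop :=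
  ∀ s < k, 2 * w ∣ s → slice D s (min (s + 2 * w) N) = mergedBlock key S w N s

/-- The blocks `[s, s + w)` and `[s + w, s + 2w)` of `S` are being merged into `D`: position `k` of
`D` is the next to be filled, `i` and `j` are the heads of what is left of the two blocks. -/
structure MergeInProgress (S D : ℕ → ℕ) (w N s k i j : ℕ) : Prop where
  dvd : 2 * w ∣ s
  mergedBelow : MergedBelow key S D w N s
  le_left : s ≤ i
  left_le : i ≤ min (s + w) N
  le_right : min (s + w) N ≤ j
  right_le : j ≤ min (s + 2 * w) N
  add_eq : k + min (s + w) N = i + j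
  append_merge : slice D s k ++ (slice S i (min (s + w) N)).merge
    (slice S j (min (s + 2 * w) N)) (fun e f => decide (key e ≤ key f)) = mergedBlock key S w N s

variable {key} {S D : ℕ → ℕ} {w N s k i j : ℕ}

theorem blockSorted_one : BlockSorted key S 1 N := by
  intro s _
  obtain h | h := Nat.lt_or_ge s N
  · rw [min_eq_left h, slice_eq_cons S s.lt_succ_self, slice_eq_nil S le_rfl]
    exact List.pairwise_singleton _ _
  · rw [slice_eq_nil S (by omega)]
    exact .nil

theorem mergedBlock_perm : (mergedBlock key S w N s).Perm (slice S s (min (s + 2 * w) N)) := by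
  obtain h | h := Nat.lt_or_ge s N
  · rw [← slice_append S (j := min (s + w) N) (by omega) (by omega)]
    exact List.merge_perm_append _
  · simp [mergedBlock, slice_eq_nil S (show min (s + w) N ≤ s by omega),
      slice_eq_nil S (show min (s + 2 * w) N ≤ s by omega),
      slice_eq_nil S (show min (s + 2 * w) N ≤ min (s + w) N by omega)]

theorem BlockSorted.pairwise_mergedBlock (hS : BlockSorted key S w N) (hs : 2 * w ∣ s) :
    (mergedBlock key S w N s).Pairwise fun e f => key e ≤ key f := by
  have hws : w ∣ s := (Dvd.intro_left 2 rfl).trans hs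
  have hright : (slice S (min (s + w) N) (min (s + 2 * w) N)).Pairwise
      fun e f => key e ≤ key f := by
    obtain h | h := Nat.lt_or_ge (s + w) N
    · rw [min_eq_left h.le, show s + 2 * w = s + w + w by omega]
      exact hS _ (hws.add dvd_rfl)
    · rw [slice_eq_nil S (by omega)]
      exact .nil
  have := List.pairwise_merge (le := fun e f => decide (key e ≤ key f))
    (by simpa using fun e f g => le_trans) (by simpa using fun e f => le_total _ _) _ _
    (by simpa using hS s hws) (by simpa using hright)
  simpa [mergedBlock] using this

theorem MergedBelow.blockSorted (hS : BlockSorted key S w N) (h : MergedBelow key S D w N N) :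
    BlockSorted key D (2 * w) N := by
  intro s hs
  obtain hsN | hsN := Nat.lt_or_ge s N
  · exact h s hsN hs ▸ hS.pairwise_mergedBlock hs
  · rw [slice_eq_nil D (by omega)]
    exact .nil

theorem MergedBelow.perm (hw : 0 < w) (h : MergedBelow key S D w N N) :
    (slice D 0 N).Perm (slice S 0 N) := by
  have hblocks : ∀ t, (slice D 0 (min (2 * w * t) N)).Perm (slice S 0 (min (2 * w * t) N)) := by
    intro t
    induction t with
    | zero => simp [slice_eq_nil]
    | succ t ih =>
      obtain ht | ht := Nat.lt_or_ge (2 * w * t) N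
      · rw [Nat.mul_succ, ← slice_append D (Nat.zero_le (2 * w * t)) (by omega),
          ← slice_append S (Nat.zero_le (2 * w * t)) (by omega), h _ ht (Dvd.intro t rfl)]
        rw [min_eq_left ht.le] at ih
        exact ih.append mergedBlock_perm
      · rwa [Nat.mul_succ, min_eq_right (by omega), ← min_eq_right ht]
  have := hblocks N
  rwa [min_eq_right (by nlinarith)] at this

theorem MergedBelow.update (h : MergedBelow key S D w N s) (hs : 2 * w ∣ s) (hk : s ≤ k) (v : ℕ) :
    MergedBelow key S (Function.update D k v) w N s := by
  intro r hr hdvd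
  rw [← h r hr hdvd]
  refine slice_congr fun p _ hp => Function.update_of_ne ?_ _ _
  have : r + 2 * w ≤ s := by
    obtain ⟨t, rfl⟩ := hs
    obtain ⟨u, rfl⟩ := hdvd
    have := Nat.mul_le_mul_left (2 * w) (Nat.lt_of_mul_lt_mul_left hr)
    rwa [Nat.mul_succ] at this
  omega

theorem MergedBelow.mergeInProgress (h : MergedBelow key S D w N k) (hk : 2 * w ∣ k)
    (hkN : k < N) : MergeInProgress key S D w N k k k (min (k + w) N) where
  dvd := hk
  mergedBelow := h
  le_left := le_rfl
  left_le := by omega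
  le_right := le_rfl
  right_le := by omega
  add_eq := rfl
  append_merge := by rw [slice_eq_nil D le_rfl, List.nil_append, mergedBlock]

namespace MergeInProgress

theorem takeLeft (h : MergeInProgress key S D w N s k i j) (hi : i < min (s + w) N)
    (hle : j < min (s + 2 * w) N → key (S i) ≤ key (S j)) :
    MergeInProgress key S (Function.update D k (S i)) w N s (k + 1) (i + 1) j where
  dvd := h.dvd
  mergedBelow := h.mergedBelow.update h.dvd (by grind [h.le_left, h.le_right, h.add_eq]) _
  le_left := h.le_left.trans i.le_succ
  left_le := hi
  le_right := h.le_right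
  right_le := h.right_le
  add_eq := by have := h.add_eq; omega
  append_merge := by
    rw [← h.append_merge, slice_update_succ _ _ (by grind [h.le_left, h.le_right, h.add_eq]),
      List.append_assoc, List.singleton_append, slice_eq_cons S hi]
    obtain hj | hj := Nat.lt_or_ge j (min (s + 2 * w) N)
    · rw [slice_eq_cons S hj, List.cons_merge_cons_pos _ _ _ (by simpa using hle hj)]
    · rw [slice_eq_nil S hj, List.merge_right, List.merge_right]

theorem takeRight (h : MergeInProgress key S D w N s k i j) (hj : j < min (s + 2 * w) N)
    (hlt : i < min (s + w) N → ¬ key (S i) ≤ key (S j)) :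
    MergeInProgress key S (Function.update D k (S j)) w N s (k + 1) i (j + 1) where
  dvd := h.dvd
  mergedBelow := h.mergedBelow.update h.dvd (by grind [h.le_left, h.le_right, h.add_eq]) _
  le_left := h.le_left
  left_le := h.left_le
  le_right := h.le_right.trans j.le_succ
  right_le := hj
  add_eq := by have := h.add_eq; omega
  append_merge := by
    rw [← h.append_merge, slice_update_succ _ _ (by grind [h.le_left, h.le_right, h.add_eq]),
      List.append_assoc, List.singleton_append, slice_eq_cons S hj]
    obtain hi | hi := Nat.lt_or_ge i (min (s + w) N)
    · rw [slice_eq_cons S hi, List.cons_merge_cons_neg _ _ _ (by simpa using hlt hi)]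
    · rw [slice_eq_nil S hi, List.nil_merge, List.nil_merge]

theorem mergedBelow_of_le (h : MergeInProgress key S D w N s k i j)
    (hk : min (s + 2 * w) N ≤ k) : (k = N ∨ 2 * w ∣ k) ∧ MergedBelow key S D w N k := by
  obtain ⟨hdvd, hbelow, -, hi, hj, hje, hadd, happend⟩ := h
  obtain rfl : k = min (s + 2 * w) N := by omega
  rw [slice_eq_nil S (by omega : min (s + w) N ≤ i), List.nil_merge,
    slice_eq_nil S (by omega : min (s + 2 * w) N ≤ j), List.append_nil] at happend
  refine ⟨?_, fun r hr hrdvd => ?_⟩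
  · obtain h | h := Nat.lt_or_ge (s + 2 * w) N
    · exact .inr (by rw [min_eq_left h.le]; exact hdvd.add dvd_rfl)
    · exact .inl (min_eq_right h)
  · obtain hrs | hrs := Nat.lt_or_ge r s
    · exact hbelow r hrs hrdvd
    · obtain ⟨t, rfl⟩ := hdvd
      obtain ⟨u, rfl⟩ := hrdvd
      have hlt : 2 * w * u < 2 * w * (t + 1) := by rw [Nat.mul_succ]; omega
      have hw : 0 < 2 * w := Nat.pos_of_ne_zero fun h => by simp [h] at hlt
      obtain rfl : u = t := le_antisymm (Nat.le_of_lt_succ (Nat.lt_of_mul_lt_mul_left hlt))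
        (Nat.le_of_mul_le_mul_left hrs hw)
      exact happend

end MergeInProgress

end Merge

/-! ### Merge sort -/

-- Numbers of the integer arrays; a scalar variable is kept in cell `0` of its array.
namespace Reg

abbrev nPoints : ℕ := 4
abbrev perm : ℕ := 5
abbrev permTmp : ℕ := 6
abbrev width : ℕ := 7
abbrev counter : ℕ := 8
abbrev leftPos : ℕ := 9
abbrev leftEnd : ℕ := 10
abbrev rightPos : ℕ := 11
abbrev rightEnd : ℕ := 12

end Reg

open Reg

/-- The pair of real cells number `e`, in the lexicographic order. -/
def lexKey (u v : ℕ → ℝ) (e : ℕ) : ℝ ×ₗ ℝ := toLex (u e, v e)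

/-- The comparison `≤` of the keys number `e` and `f` of the pair of real arrays `a` and `b`. -/
def lexTest (a b : ℕ) (e f : NExp) : Test :=
  .not (.and (.realLE a f a e) (.not (.and (.realLE a e a f) (.realLE b e b f))))

theorem lexTest_holds (a b : ℕ) (e f : NExp) (m : Memory) : (lexTest a b e f).Holds m ↔
    lexKey (m.real a) (m.real b) (e.eval m) ≤ lexKey (m.real a) (m.real b) (f.eval m) := by
  simp only [lexTest, Test.Holds, lexKey, Prod.Lex.toLex_le_toLex]
  grind

/-- The minimum of two integer expressions. -/
def minExp (e f : NExp) : NExp := .sub e (.sub e f)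

@[simp] theorem minExp_eval (e f : NExp) (m : Memory) :
    (minExp e f).eval m = min (e.eval m) (f.eval m) := by
  simp only [minExp, NExp.eval]; omega

/-- Open the next two blocks, unless a merge is in progress. -/
def openBlocks : Program :=
  .branch (.natLE (var rightEnd) (var counter))
    (.seq (assign leftPos (var counter))
      (.seq (assign leftEnd (minExp (.add (var counter) (var width)) (var nPoints)))
        (.seq (assign rightPos (var leftEnd))
          (assign rightEnd
            (minExp (.add (var counter) (.mul (.const 2) (var width))) (var nPoints))))))
    .skip

/-- Move the smaller of the heads of the two blocks to `permTmp`. -/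
def moveHead (a b : ℕ) : Program :=
  .branch (.and (ltTest (var leftPos) (var leftEnd))
      (.not (.and (ltTest (var rightPos) (var rightEnd))
        (.not (lexTest a b (.read perm (var leftPos)) (.read perm (var rightPos)))))))
    (.seq (.store permTmp (var counter) (.read perm (var leftPos)))
      (assign leftPos (.add (var leftPos) (.const 1))))
    (.seq (.store permTmp (var counter) (.read perm (var rightPos)))
      (assign rightPos (.add (var rightPos) (.const 1))))

/-- Merge the blocks of length `width` of `perm` in pairs into `permTmp`. -/
def mergePass (a b : ℕ) : Program :=
  .seq (assign rightEnd (.const 0)) (forLoop counter nPoints (.seq openBlocks (moveHead a b)))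

/-- Merge the blocks of length `width` of `perm` in pairs and double `width`. -/
def sortRound (a b : ℕ) : Program :=
  .seq (mergePass a b)
    (.seq (forLoop counter nPoints (.store perm (var counter) (.read permTmp (var counter))))
      (assign width (.mul (.const 2) (var width))))

/-- Bottom-up merge sort: writes the numbers below `nPoints` to `perm`, sorted by the pairs of
cells of the real arrays `a` and `b`. -/
def sortProgram (a b : ℕ) : Program :=
  .seq (forLoop counter nPoints (.store perm (var counter) (var counter)))
    (.seq (assign width (.const 1))
      (.loop (ltTest (var width) (var nPoints)) (sortRound a b)))

theorem writes_mergePass (a b : ℕ) : (mergePass a b).writes =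
    [rightEnd, counter, leftPos, leftEnd, rightPos, rightEnd, permTmp, leftPos, permTmp, rightPos,
      counter] :=
  rfl

theorem writes_sortRound (a b : ℕ) : (sortRound a b).writes =
    (mergePass a b).writes ++ [counter, perm, counter, width] :=
  rfl

/-- Position `k` of `permTmp` is the next to be filled by the merge in progress. -/
def MergeOpen {α : Type*} [LinearOrder α] (key : ℕ → α) (w N k : ℕ) (m : Memory) : Prop :=
  k < m.nat rightEnd 0 ∧ ∃ s, m.nat leftEnd 0 = min (s + w) N ∧
    m.nat rightEnd 0 = min (s + 2 * w) N ∧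
    MergeInProgress key (m.nat perm) (m.nat permTmp) w N s k (m.nat leftPos 0) (m.nat rightPos 0)

/-- All positions of `permTmp` below `k` are filled, and no merge is in progress. -/
def MergeClosed {α : Type*} [LinearOrder α] (key : ℕ → α) (w N k : ℕ) (m : Memory) : Prop :=
  m.nat rightEnd 0 ≤ k ∧ (k = N ∨ 2 * w ∣ k) ∧
    MergedBelow key (m.nat perm) (m.nat permTmp) w N k

theorem MergeInProgress.closed_or_open {α : Type*} [LinearOrder α] {key : ℕ → α} {w N s k : ℕ}
    {m : Memory} (h : MergeInProgress key (m.nat perm) (m.nat permTmp) w N s k (m.nat leftPos 0)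
      (m.nat rightPos 0))
    (hleft : m.nat leftEnd 0 = min (s + w) N) (hright : m.nat rightEnd 0 = min (s + 2 * w) N) :
    MergeClosed key w N k m ∨ MergeOpen key w N k m := by
  obtain hk | hk := Nat.lt_or_ge k (m.nat rightEnd 0)
  · exact .inr ⟨hk, s, hleft, hright, h⟩
  · exact .inl ⟨hk, h.mergedBelow_of_le (hright ▸ hk)⟩

theorem runs_openBlocks {α : Type*} [LinearOrder α] {key : ℕ → α} {W N w k : ℕ} {m : Memory}
    (hN : m.nat nPoints 0 = N) (hw : m.nat width 0 = w) (hk : m.nat counter 0 = k)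
    (hw₀ : 0 < w) (hkN : k < N) (hW : N < W)
    (h : MergeClosed key w N k m ∨ MergeOpen key w N k m) :
    Runs W openBlocks m 60 (MergeOpen key w N k) := by
  refine .of_wp (by simp [openBlocks, Program.NatOnly]) (by decide) ?_
  simp only [openBlocks, Program.wp, Test.Holds, NExp.eval, minExp_eval, Memory.nat_setNat,
    hN, hw, hk]
  refine ⟨fun hclosed => ?_, fun hopen => h.resolve_left fun h => hopen h.1⟩
  obtain ⟨-, hdvd, hbelow⟩ := h.resolve_right fun h => absurd h.1 (by omega)
  have hopened := hbelow.mergeInProgress (hdvd.resolve_left hkN.ne) hkN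
  refine ⟨by omega, by simp; omega, by simp; omega, by simp; omega, by simp; omega, k, ?_⟩
  simpa using hopened

theorem runs_moveHead {W N w a b k : ℕ} {m : Memory} (hk : m.nat counter 0 = k) (hW : N < W)
    (hperm : ∀ p < N, m.nat perm p < N)
    (h : MergeOpen (lexKey (m.real a) (m.real b)) w N k m) :
    Runs W (moveHead a b) m 120 fun m' =>
      MergeClosed (lexKey (m.real a) (m.real b)) w N (k + 1) m' ∨
        MergeOpen (lexKey (m.real a) (m.real b)) w N (k + 1) m' := by
  obtain ⟨hkr, s, hleft, hright, hmerge⟩ := h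
  have hadd := hmerge.add_eq
  refine .of_wp (by simp [moveHead, Program.NatOnly])
    (by simp [Program.time, NExp.cost, Test.cost, moveHead, lexTest]) ?_
  simp only [moveHead, Program.wp, Test.Holds, NExp.eval, lexTest_holds, hk]
  refine ⟨fun ⟨_, hj⟩ => ?_, fun hij => ?_⟩
  · have hle (hje : m.nat rightPos 0 < m.nat rightEnd 0) := not_not.1 fun hle => hj ⟨hje, hle⟩
    have hlt := hperm (m.nat leftPos 0) (by omega)
    refine ⟨by omega, by simp; omega, ?_⟩
    refine MergeInProgress.closed_or_open (s := s) ?_ (by simpa using hleft) (by simpa using hright)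
    simpa using hmerge.takeLeft (by omega) fun hj => hle (by omega)
  · have hj : m.nat rightPos 0 < m.nat rightEnd 0 := by
      by_contra hj
      exact hij ⟨by omega, fun h => hj h.1⟩
    have hlt := hperm (m.nat rightPos 0) (by omega)
    refine ⟨by omega, by simp; omega, ?_⟩
    refine MergeInProgress.closed_or_open (s := s) ?_ (by simpa using hleft) (by simpa using hright)
    simpa using hmerge.takeRight (by omega) fun hi hle => hij ⟨by omega, fun h => h.2 hle⟩

theorem runs_mergePass {W N w a b : ℕ} {m : Memory} (hN : m.nat nPoints 0 = N)
    (hw : m.nat width 0 = w) (hw₀ : 0 < w) (hW : N < W) (hperm : ∀ p < N, m.nat perm p < N) :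
    Runs W (mergePass a b) m (200 * N + 20) fun m' =>
      MergedBelow (lexKey (m.real a) (m.real b)) (m.nat perm) (m'.nat permTmp) w N N := by
  set key := lexKey (m.real a) (m.real b)
  refine .assign_seq (T := 200 * N + 11) (by simp [NExp.eval]; omega) ?_
    (by simp [NExp.cost]; omega)
  refine (Runs.forLoop (N := N) (T := 180)
    (fun k m' => m'.nat perm = m.nat perm ∧ (MergeClosed key w N k m' ∨ MergeOpen key w N k m'))
    (by simp [Program.writes, openBlocks, moveHead])
    (by simp [Program.writes, openBlocks, moveHead]) (by simpa using hN) hW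
    ⟨by simp, .inl ⟨by simp [NExp.eval], .inr (dvd_zero _), fun _ h => absurd h (by omega)⟩⟩
    ?_ (by omega)).mono le_rfl ?_
  · rintro k m₁ hkN hm₁ hk ⟨hS, hI⟩
    have hreal : m₁.real = m.real := hm₁.real
    have hN₁ : m₁.nat nPoints 0 = N := by
      rw [hm₁.nat _ (by simp [Program.writes, openBlocks, moveHead])]; simpa using hN
    have hw₁ : m₁.nat width 0 = w := by
      rw [hm₁.nat _ (by simp [Program.writes, openBlocks, moveHead])]; simpa using hw
    refine (runs_openBlocks hN₁ hw₁ hk hw₀ hkN hW hI).seq (U := 120) (fun m₂ hm₂ hopen => ?_)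
      (by omega)
    have hkey : lexKey (m₂.real a) (m₂.real b) = key := by rw [hm₂.real, hreal]
    have hS₂ : m₂.nat perm = m.nat perm := by rw [hm₂.nat _ (by decide), hS]
    refine (runs_moveHead (a := a) (b := b) (hm₂.nat counter (by decide) ▸ hk) hW (hS₂ ▸ hperm)
      (hkey ▸ hopen)).mono le_rfl fun m₃ hm₃ hI₃ => ⟨?_, ?_⟩
    · simpa [hS₂] using hm₃.nat perm (by simp [Program.writes, moveHead])
    · simpa [MergeClosed, MergeOpen, hkey] using hI₃
  · rintro m' - ⟨hS, ⟨-, -, h⟩ | ⟨hlt, s, -, hend, -⟩⟩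
    · rwa [hS] at h
    · omega

theorem runs_sortRound {W N w a b : ℕ} {m : Memory} (hN : m.nat nPoints 0 = N)
    (hw : m.nat width 0 = w) (hw₀ : 0 < w) (hwN : w < N) (hW : 2 * N < W)
    (hperm : (slice (m.nat perm) 0 N).Perm (List.range N))
    (hsorted : BlockSorted (lexKey (m.real a) (m.real b)) (m.nat perm) w N) :
    Runs W (sortRound a b) m (240 * N + 60) fun m' => m'.nat width 0 = 2 * w ∧
      (slice (m'.nat perm) 0 N).Perm (List.range N) ∧
      BlockSorted (lexKey (m.real a) (m.real b)) (m'.nat perm) (2 * w) N := by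
  have hlt {S : ℕ → ℕ} (hS : (slice S 0 N).Perm (List.range N)) {p} (hp : p < N) : S p < N := by
    rw [← List.mem_range, ← hS.mem_iff, mem_slice]
    exact ⟨p, Nat.zero_le p, hp, rfl⟩
  refine (runs_mergePass (a := a) (b := b) hN hw hw₀ (by omega) fun _ => hlt hperm).seq
    (U := 40 * N + 40) (fun m₁ hm₁ hmerged => ?_) (by omega)
  have hperm₁ : (slice (m₁.nat permTmp) 0 N).Perm (List.range N) := (hmerged.perm hw₀).trans hperm
  have hN₁ : m₁.nat nPoints 0 = N := by
    rw [hm₁.nat _ (by simp [writes_mergePass]), hN]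
  have hw₁ : m₁.nat width 0 = w := by
    rw [hm₁.nat _ (by simp [writes_mergePass]), hw]
  have hcopy := Runs.storeLoop (W := W) (k := counter) (b := nPoints) (dst := perm)
    (i := var counter) (e := .read permTmp (var counter)) (f := m₁.nat permTmp) (g := id)
    (T := 40 * N + 11) (by decide) (by decide) hN₁ (by omega) Function.injective_id.injOn
    (fun p hp m' hm' hk => ⟨hk, by simp [NExp.eval, hk, hm'.nat permTmp],
      (hlt hperm₁ hp).trans (by omega)⟩) (by simp [NExp.cost]; omega)
  refine hcopy.seq (U := 20) (fun m₂ hm₂ hperm₂ => ?_) (by omega)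
  have hslice {i j} (hj : j ≤ N) : slice (m₂.nat perm) i j = slice (m₁.nat permTmp) i j :=
    slice_congr fun p _ hp => hperm₂ p (hp.trans_le hj)
  refine .of_wp trivial (by decide) ?_
  have hw₂ : m₂.nat width 0 = w := by rw [hm₂.nat _ (by decide), hw₁]
  simp only [Program.wp, NExp.eval, hw₂]
  refine ⟨by omega, by simp, ?_, fun s hs => ?_⟩
  · simpa [hslice le_rfl] using hperm₁
  · simpa [hslice (min_le_right _ _)] using hmerged.blockSorted hsorted s hs

/-- `S` enumerates the numbers below `N`, each once, by increasing key. -/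
structure Sorts {α : Type*} [LinearOrder α] (key : ℕ → α) (S : ℕ → ℕ) (N : ℕ) : Prop where
  perm : (slice S 0 N).Perm (List.range N)
  le : ∀ i j, i ≤ j → j < N → key (S i) ≤ key (S j)

theorem BlockSorted.le {α : Type*} [LinearOrder α] {key : ℕ → α} {S : ℕ → ℕ} {w N i j : ℕ}
    (h : BlockSorted key S w N) (hw : N ≤ w) (hij : i ≤ j) (hj : j < N) :
    key (S i) ≤ key (S j) := by
  obtain rfl | hlt := hij.eq_or_lt
  · rfl
  have hsorted := h 0 (dvd_zero w)
  rw [zero_add, min_eq_right hw, slice, List.pairwise_map] at hsorted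
  simpa using List.pairwise_iff_getElem.1 hsorted i j (by simpa using hlt.trans hj)
    (by simpa using hj) hlt

theorem runs_sortLoop {W N a b : ℕ} {m : Memory} (hN : m.nat nPoints 0 = N)
    (hw : m.nat width 0 = 1) (hW : 2 * N < W)
    (hperm : (slice (m.nat perm) 0 N).Perm (List.range N)) :
    Runs W (.loop (ltTest (var width) (var nPoints)) (sortRound a b)) m
      (250 * (N + 1) * Nat.clog 2 N + 10) fun m' =>
      Sorts (lexKey (m.real a) (m.real b)) (m'.nat perm) N := by
  have hbound {m'} (hm : Frame (sortRound a b).writes m m') : m'.nat nPoints 0 = N := by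
    rw [hm.nat _ (by simp [writes_sortRound, writes_mergePass]), hN]
  refine (Runs.loop (T := 240 * N + 60) (fun m' => ∃ r, m'.nat width 0 = 2 ^ r ∧
    (slice (m'.nat perm) 0 N).Perm (List.range N) ∧
    BlockSorted (lexKey (m.real a) (m.real b)) (m'.nat perm) (2 ^ r) N)
    (fun m' => Nat.clog 2 N - Nat.log 2 (m'.nat width 0))
    ⟨0, hw, hperm, blockSorted_one⟩ ?_ ?_).mono le_rfl ?_
  · rintro m₁ hm₁ ⟨r, hr, hperm, hsorted⟩ hlt
    have hrN : 2 ^ r < N := by simpa [Test.Holds, NExp.eval, hr, hbound hm₁] using hlt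
    rw [← hm₁.real] at hsorted ⊢
    refine (runs_sortRound (hbound hm₁) hr (by positivity) hrN hW hperm hsorted).mono le_rfl
      fun m₂ _ ⟨hw, hperm, hsorted⟩ => ⟨⟨r + 1, by rw [hw, pow_succ'], hperm, ?_⟩, ?_⟩
    · rwa [pow_succ']
    · rw [hw, hr, ← pow_succ', Nat.log_pow one_lt_two, Nat.log_pow one_lt_two]
      have := (Nat.lt_clog_iff_pow_lt one_lt_two).2 hrN
      omega
  · simp only [Test.cost, NExp.cost, hw, Nat.log_one_right, Nat.sub_zero]
    nlinarith [Nat.zero_le (N * Nat.clog 2 N)]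
  · rintro m₁ hm₁ ⟨⟨r, hr, hperm, hsorted⟩, hge⟩
    have hrN : N ≤ 2 ^ r := by simpa [Test.Holds, NExp.eval, hr, hbound hm₁] using hge
    exact ⟨hperm, fun i j => hsorted.le hrN⟩

theorem runs_sortProgram {W N a b : ℕ} {m : Memory} (hN : m.nat nPoints 0 = N)
    (hW : 2 * N + 1 < W) :
    Runs W (sortProgram a b) m (300 * (N + 1) * (Nat.clog 2 N + 1)) fun m' =>
      Sorts (lexKey (m.real a) (m.real b)) (m'.nat perm) N := by
  have hinit := Runs.storeLoop (W := W) (k := counter) (b := nPoints) (dst := perm)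
    (i := var counter) (e := var counter) (f := id) (g := id) (T := 30 * N + 11)
    (by decide) (by decide) hN (by omega) Function.injective_id.injOn
    (fun p hp m' _ hk => ⟨hk, hk, by simp; omega⟩) (by simp [NExp.cost]; omega)
  refine hinit.seq (U := 250 * (N + 1) * Nat.clog 2 N + 13) (fun m₁ hm₁ hid => ?_)
    (by nlinarith [Nat.zero_le (N * Nat.clog 2 N)])
  have hslice : slice (m₁.nat perm) 0 N = List.range N := by
    rw [slice_congr (S := m₁.nat perm) (D := id) fun p _ => hid p, slice, List.map_id,
      Nat.sub_zero, List.range_eq_range']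
  refine .assign_seq (T := 250 * (N + 1) * Nat.clog 2 N + 10) (by simp [NExp.eval]; omega)
    (hm₁.real ▸ runs_sortLoop ?_ ?_ (by omega) ?_)
    (by simp [NExp.cost]; omega)
  · rw [Memory.nat_setNat_of_ne _ _ _ _ _ (by decide), hm₁.nat _ (by decide), hN]
  · simp [NExp.eval]
  · rw [Memory.nat_setNat_of_ne _ _ _ _ _ (by decide), hslice]

theorem Sorts.bijOn {α : Type*} [LinearOrder α] {key : ℕ → α} {S : ℕ → ℕ} {N : ℕ}
    (h : Sorts key S N) : Set.BijOn S (Set.Iio N) (Set.Iio N) := by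
  have hmem {e : ℕ} : e ∈ slice S 0 N ↔ e < N := by rw [h.perm.mem_iff, List.mem_range]
  refine ⟨fun k hk => hmem.1 (mem_slice.2 ⟨k, k.zero_le, hk, rfl⟩), ?_, fun e he => ?_⟩
  · have hnodup := h.perm.nodup_iff.2 List.nodup_range
    rw [slice, Nat.sub_zero, ← List.range_eq_range'] at hnodup
    exact fun i hi j hj => List.inj_on_of_nodup_map hnodup (List.mem_range.2 hi)
      (List.mem_range.2 hj)
  · obtain ⟨k, -, hk, rfl⟩ := mem_slice.1 (hmem.2 he)
    exact ⟨k, hk, rfl⟩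

end RealRAM

namespace Stabbing

open RealRAM Finset

section RankSpace

/-! ### Stabbing rectangles in rank space -/

/-- A linear order on the numbers below `N`: `seq` lists them in increasing order, and `rank e` is
the position of `e` in the list.  The values of both functions beyond `N` are irrelevant. -/
structure Ranking (N : ℕ) where
  seq : ℕ → ℕ
  rank : ℕ → ℕ
  seq_lt : ∀ k < N, seq k < N
  rank_lt : ∀ e < N, rank e < N
  rank_seq : ∀ k < N, rank (seq k) = k
  seq_rank : ∀ e < N, seq (rank e) = e

theorem Ranking.rank_ne_of_ne_seq {N k e : ℕ} (z : Ranking N) (he : e < N) (h : e ≠ z.seq k) :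
    z.rank e ≠ k := fun hk => h (by rw [← hk, z.seq_rank e he])

/-- The opposite order. -/
def Ranking.reverse {N : ℕ} (x : Ranking N) : Ranking N where
  seq k := x.seq (N - 1 - k)
  rank e := N - 1 - x.rank e
  seq_lt k hk := x.seq_lt _ (by omega)
  rank_lt e he := by omega
  rank_seq k hk := by rw [x.rank_seq _ (by omega)]; omega
  seq_rank e he := by
    have := x.rank_lt e he
    rw [show N - 1 - (N - 1 - x.rank e) = x.rank e by omega, x.seq_rank e he]

theorem Ranking.reverse_seq_sub {N k : ℕ} (x : Ranking N) (hk : k < N) :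
    x.reverse.seq (N - 1 - k) = x.seq k := by
  simp only [reverse, show N - 1 - (N - 1 - k) = k by omega]

/-- The other endpoint of the segment of endpoint number `e`. -/
def mate (e : ℕ) : ℕ := 4 * (e / 2) + 1 - e

theorem mate_mate (e : ℕ) : mate (mate e) = e := by unfold mate; omega

theorem mate_lt {n e : ℕ} (h : e < 2 * n) : mate e < 2 * n := by unfold mate; omega

variable {n : ℕ}

/-- The point number `e`, at abscissa `x.rank e` and height `y.rank e`, lies in the half-open
bottomless rectangle `[a, b) × (-∞, c)`. -/
def InBox (x y : Ranking (2 * n)) (a b c e : ℕ) : Prop :=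
  a ≤ x.rank e ∧ x.rank e < b ∧ y.rank e < c

/-- The set `B` of points contains exactly one endpoint of the segment of endpoint number `e`. -/
def IsSplit (B : ℕ → Prop) (e : ℕ) : Prop := B e ↔ ¬ B (mate e)

theorem isSplit_mate_iff (B : ℕ → Prop) (e : ℕ) : IsSplit B (mate e) ↔ IsSplit B e := by
  simp only [IsSplit, mate_mate]
  tauto

theorem isSplit_two_mul_half_iff (B : ℕ → Prop) (e : ℕ) :
    IsSplit B (2 * (e / 2)) ↔ IsSplit B e := by
  have h : e = 2 * (e / 2) ∨ mate e = 2 * (e / 2) := by unfold mate; omega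
  obtain h | h := h
  · rw [← h]
  · rw [← h, isSplit_mate_iff]

/-- In rank space, the closed rectangle with left side `a`, right side `b` and top side `c` is
stabbing and has a point on each of its sides. -/
structure IsStabber (x y : Ranking (2 * n)) (a b c : ℕ) : Prop where
  left_lt : a < 2 * n
  right_lt : b < 2 * n
  top_lt : c < 2 * n
  left : InBox x y a (b + 1) (c + 1) (x.seq a)
  right : InBox x y a (b + 1) (c + 1) (x.seq b)
  top : InBox x y a (b + 1) (c + 1) (y.seq c)
  stabs : ∀ e < 2 * n, IsSplit (InBox x y a (b + 1) (c + 1)) e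

/-- The least `z`-rank `k` such that each segment has an endpoint of `z`-rank at most `k`, and so
has the mate of each of the first `a` points of `x`. -/
def reach (x z : Ranking (2 * n)) (a : ℕ) : ℕ :=
  ((range (2 * n)).sup fun e => min (z.rank e) (z.rank (mate e))) ⊔
    (range a).sup fun j => z.rank (mate (x.seq j))

theorem reach_succ (x z : Ranking (2 * n)) (a : ℕ) :
    reach x z (a + 1) = max (reach x z a) (z.rank (mate (x.seq a))) := by
  rw [reach, range_add_one, sup_insert, sup_comm (z.rank _), ← sup_assoc, reach]

theorem reach_le_iff {x z : Ranking (2 * n)} {a k : ℕ} : reach x z a ≤ k ↔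
    (∀ e < 2 * n, min (z.rank e) (z.rank (mate e)) ≤ k) ∧
      ∀ j < a, z.rank (mate (x.seq j)) ≤ k := by
  simp [reach]

theorem reach_le_iff_rank {x z : Ranking (2 * n)} {a k : ℕ} (ha : a ≤ 2 * n) : reach x z a ≤ k ↔
    (∀ e < 2 * n, min (z.rank e) (z.rank (mate e)) ≤ k) ∧
      ∀ e < 2 * n, x.rank e < a → z.rank (mate e) ≤ k := by
  rw [reach_le_iff]
  refine and_congr_right fun _ => ⟨fun H e he hea => ?_, fun H j hj => ?_⟩
  · simpa only [x.seq_rank e he] using H _ hea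
  · exact H _ (x.seq_lt j (by omega)) (by rwa [x.rank_seq j (by omega)])

theorem reach_lt {x z : Ranking (2 * n)} {a : ℕ} (hn : 0 < n) (ha : a ≤ 2 * n) :
    reach x z a < 2 * n := by
  refine Nat.lt_of_le_pred (by omega) (reach_le_iff.2 ⟨fun e he => ?_, fun j hj => ?_⟩)
  · exact min_le_of_left_le (Nat.le_pred_of_lt (z.rank_lt e he))
  · exact Nat.le_pred_of_lt (z.rank_lt _ (mate_lt (x.seq_lt j (hj.trans_le ha))))

theorem reach_mono (x z : Ranking (2 * n)) : Monotone (reach x z) := fun _ _ h =>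
  reach_le_iff.2 ⟨(reach_le_iff.1 le_rfl).1,
    fun j hj => (reach_le_iff.1 le_rfl).2 j (hj.trans_le h)⟩

/-- The top side of the lowest rectangle with left side `a` that may be stabbing. -/
def topOf (x y : Ranking (2 * n)) (a : ℕ) : ℕ := reach x y a

/-- The right side of the narrowest rectangle with left side `a` and top side `topOf x y a` that may
be stabbing. -/
def rightOf (x y : Ranking (2 * n)) (a : ℕ) : ℕ :=
  reach x x a ⊔ reach y.reverse x (2 * n - 1 - topOf x y a)

variable {x y : Ranking (2 * n)} {a b c a' b' c' : ℕ}

theorem topOf_lt (hn : 0 < n) (ha : a ≤ 2 * n) : topOf x y a < 2 * n := reach_lt hn ha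

theorem rightOf_lt (hn : 0 < n) (ha : a ≤ 2 * n) : rightOf x y a < 2 * n :=
  max_lt (reach_lt hn ha) (reach_lt hn (by omega))

theorem rightOf_le_iff (ha : a ≤ 2 * n) : rightOf x y a ≤ b ↔
    (∀ e < 2 * n, min (x.rank e) (x.rank (mate e)) ≤ b) ∧
      (∀ e < 2 * n, x.rank e < a → x.rank (mate e) ≤ b) ∧
      ∀ e < 2 * n, topOf x y a < y.rank e → x.rank (mate e) ≤ b := by
  rw [rightOf, sup_le_iff, reach_le_iff_rank ha, reach_le_iff_rank (by omega)]
  have habove : (∀ e < 2 * n, y.reverse.rank e < 2 * n - 1 - topOf x y a → x.rank (mate e) ≤ b) ↔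
      ∀ e < 2 * n, topOf x y a < y.rank e → x.rank (mate e) ≤ b := by
    refine forall₂_congr fun e he => imp_congr_left ?_
    have := y.rank_lt e he
    simp only [Ranking.reverse]
    omega
  tauto

namespace IsStabber

theorem topOf_le (h : IsStabber x y a b c) : topOf x y a ≤ c := by
  refine (reach_le_iff_rank h.left_lt.le).2 ⟨fun e he => ?_, fun e he hea => ?_⟩ <;>
  · have := h.stabs e he
    unfold IsSplit InBox at this
    omega

theorem rightOf_le (h : IsStabber x y a b c) (hc : c = topOf x y a) : rightOf x y a ≤ b := by
  refine (rightOf_le_iff h.left_lt.le).2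
    ⟨fun e he => ?_, fun e he hea => ?_, fun e he hea => ?_⟩ <;>
  · have := h.stabs e he
    unfold IsSplit InBox at this
    omega

-- The mate of the point on the right side lies outside the rectangle, so it forces `b`.
theorem right_eq (h : IsStabber x y a b c) (hc : c = topOf x y a) : b = rightOf x y a := by
  refine le_antisymm ?_ (h.rightOf_le hc)
  obtain ⟨hmin, hleft, habove⟩ := (rightOf_le_iff h.left_lt.le).1 (le_refl (rightOf x y a))
  have hlt := x.seq_lt b h.right_lt
  have hmin := hmin _ hlt
  have hleft := hleft _ (mate_lt hlt)
  have habove := habove _ (mate_lt hlt)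
  have hstabs := h.stabs _ hlt
  have hright := h.right
  have hrank := x.rank_seq b h.right_lt
  rw [mate_mate] at hleft habove
  simp only [IsSplit, InBox] at hstabs hright
  omega

end IsStabber

theorem inBox_reverse_iff {e : ℕ} (ha : a < 2 * n) (hb : b < 2 * n) (he : e < 2 * n) :
    InBox x.reverse y (2 * n - 1 - b) (2 * n - 1 - a + 1) c e ↔ InBox x y a (b + 1) c e := by
  have := x.rank_lt e he
  simp only [InBox, Ranking.reverse]
  omega

theorem IsStabber.reverse (h : IsStabber x y a b c) :
    IsStabber x.reverse y (2 * n - 1 - b) (2 * n - 1 - a) c := by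
  have ha := h.left_lt
  have hb := h.right_lt
  refine ⟨by omega, by omega, h.top_lt, ?_, ?_, ?_, fun e he => ?_⟩
  · rw [x.reverse_seq_sub hb, inBox_reverse_iff ha hb (x.seq_lt b hb)]; exact h.right
  · rw [x.reverse_seq_sub ha, inBox_reverse_iff ha hb (x.seq_lt a ha)]; exact h.left
  · rw [inBox_reverse_iff ha hb (y.seq_lt c h.top_lt)]; exact h.top
  · rw [IsSplit, inBox_reverse_iff ha hb he, inBox_reverse_iff ha hb (mate_lt he)]
    exact h.stabs e he

theorem isStabber_reverse_iff (ha : a < 2 * n) (hb : b < 2 * n) :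
    IsStabber x.reverse y (2 * n - 1 - b) (2 * n - 1 - a) c ↔ IsStabber x y a b c := by
  refine ⟨fun h => ?_, IsStabber.reverse⟩
  obtain ⟨-, -, hc, hl, hr, ht, hs⟩ := h
  rw [x.reverse_seq_sub hb, inBox_reverse_iff ha hb (x.seq_lt b hb)] at hl
  rw [x.reverse_seq_sub ha, inBox_reverse_iff ha hb (x.seq_lt a ha)] at hr
  rw [inBox_reverse_iff ha hb (y.seq_lt c hc)] at ht
  refine ⟨ha, hb, hc, hr, hl, ht, fun e he => ?_⟩
  rw [IsSplit, ← inBox_reverse_iff ha hb he, ← inBox_reverse_iff ha hb (mate_lt he)]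
  exact hs e he

-- The mate of the point on the top side lies to the left or to the right of the rectangle, or
-- above it, so one of the three constraints that define the two candidates forces `c`.
theorem IsStabber.top_eq (h : IsStabber x y a b c) :
    c = topOf x y a ∨ c = topOf x.reverse y (2 * n - 1 - b) := by
  have hle := h.topOf_le
  have hle' := h.reverse.topOf_le
  have hb := h.right_lt
  obtain ⟨hmin, hleft⟩ := (reach_le_iff_rank h.left_lt.le).1 (le_refl (topOf x y a))
  obtain ⟨-, hright⟩ := (reach_le_iff_rank (by omega)).1
    (le_refl (topOf x.reverse y (2 * n - 1 - b)))
  have hlt := y.seq_lt c h.top_lt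
  have hmin := hmin _ hlt
  have hleft := hleft _ (mate_lt hlt)
  have hright := hright _ (mate_lt hlt)
  have hstabs := h.stabs _ hlt
  have htop := h.top
  have hrank := y.rank_seq c h.top_lt
  have hrank' := x.rank_lt _ (mate_lt hlt)
  have hreverse : x.reverse.rank (mate (y.seq c)) = 2 * n - 1 - x.rank (mate (y.seq c)) := rfl
  rw [mate_mate] at hleft hright
  simp only [IsSplit, InBox] at hstabs htop
  omega

theorem IsStabber.eq_of_inBox_iff (h : IsStabber x y a b c) (h' : IsStabber x y a' b' c')
    (hin : ∀ e < 2 * n, InBox x y a (b + 1) (c + 1) e ↔ InBox x y a' (b' + 1) (c' + 1) e) :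
    a = a' ∧ b = b' ∧ c = c' := by
  have hleft := (hin _ (x.seq_lt a h.left_lt)).1 h.left
  have hright := (hin _ (x.seq_lt b h.right_lt)).1 h.right
  have htop := (hin _ (y.seq_lt c h.top_lt)).1 h.top
  have hleft' := (hin _ (x.seq_lt a' h'.left_lt)).2 h'.left
  have hright' := (hin _ (x.seq_lt b' h'.right_lt)).2 h'.right
  have htop' := (hin _ (y.seq_lt c' h'.top_lt)).2 h'.top
  simp only [InBox, x.rank_seq _ h.left_lt, x.rank_seq _ h.right_lt, y.rank_seq _ h.top_lt,
    x.rank_seq _ h'.left_lt, x.rank_seq _ h'.right_lt, y.rank_seq _ h'.top_lt] at *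
  omega

end RankSpace

section Plane

/-! ### Rectangles in the plane and in rank space -/

/-- The ranking of the numbers below `N` in which a sorting sequence lists them. -/
noncomputable def rankingOfSorts {α : Type*} [LinearOrder α] {key : ℕ → α} {S : ℕ → ℕ} {N : ℕ}
    (h : Sorts key S N) : Ranking N where
  seq := S
  rank := Function.invFunOn S (Set.Iio N)
  seq_lt := h.bijOn.mapsTo
  rank_lt := h.bijOn.surjOn.mapsTo_invFunOn
  rank_seq := h.bijOn.invOn_invFunOn.1
  seq_rank := h.bijOn.invOn_invFunOn.2

theorem Ranking.key_le {α : Type*} [LinearOrder α] {key : ℕ → α} {N e f : ℕ} {x : Ranking N}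
    (h : Sorts key x.seq N) (he : e < N) (hf : f < N) (hle : x.rank e ≤ x.rank f) :
    key e ≤ key f := by
  simpa only [x.seq_rank e he, x.seq_rank f hf] using h.le _ _ hle (x.rank_lt f hf)

/-- The point number `e`, with coordinates `u e` and `v e`, lies in `bottomless α β γ`. -/
def InRectangle (u v : ℕ → ℝ) (α β γ : ℝ) (e : ℕ) : Prop :=
  α ≤ u e ∧ u e ≤ β ∧ v e ≤ γ

section InRectangle

variable {u v : ℕ → ℝ} {α β γ : ℝ} {e f g : ℕ}

theorem le_of_lexKey_le (h : lexKey u v e ≤ lexKey u v f) : u e ≤ u f := by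
  rcases Prod.Lex.toLex_le_toLex.1 h with h | h
  exacts [h.le, h.1.le]

theorem lexKey_between (hef : lexKey u v e ≤ lexKey u v f) (hfg : lexKey u v f ≤ lexKey u v g)
    (hge : u g ≤ u e) : u f = u e ∧ u f = u g ∧ v e ≤ v f ∧ v f ≤ v g := by
  have hu := le_of_lexKey_le hef
  have hu' := le_of_lexKey_le hfg
  rw [lexKey, lexKey, Prod.Lex.toLex_le_toLex] at hef hfg
  refine ⟨(hu'.trans hge).antisymm hu, hu'.antisymm (hge.trans hu), ?_, ?_⟩
  · exact (hef.resolve_left (hu'.trans hge).not_gt).2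
  · exact (hfg.resolve_left (hge.trans hu).not_gt).2

theorem InRectangle.of_lexKey_between (hg : InRectangle u v α β γ g)
    (hef : lexKey u v e ≤ lexKey u v f) (hfg : lexKey u v f ≤ lexKey u v g) (hge : u g ≤ u e) :
    InRectangle u v α β γ f := by
  obtain ⟨-, hu, -, hv⟩ := lexKey_between hef hfg hge
  exact ⟨hu ▸ hg.1, hu ▸ hg.2.1, hv.trans hg.2.2⟩

theorem InRectangle.of_lexKey_swap_between (he : InRectangle u v α β γ e)
    (hg : InRectangle u v α β γ g) (hef : lexKey v u e ≤ lexKey v u f)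
    (hfg : lexKey v u f ≤ lexKey v u g) (hge : v g ≤ v e) : InRectangle u v α β γ f := by
  obtain ⟨hv, -, hu, hu'⟩ := lexKey_between hef hfg hge
  exact ⟨he.1.trans hu, hu'.trans hg.2.1, hv.trans_le he.2.2⟩

end InRectangle

variable {n : ℕ}

/-- The point number `e` lies in the rectangle in the plane whose left, right and top sides pass
through the points at the positions `a` and `b` of `x` and `c` of `y`. -/
def InRegion (u v : ℕ → ℝ) (x y : Ranking (2 * n)) (a b c : ℕ) : ℕ → Prop :=
  InRectangle u v (u (x.seq a)) (u (x.seq b)) (v (y.seq c))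

/-- The rectangle in the plane contains no more points than the rectangle in rank space. -/
def IsTight (u v : ℕ → ℝ) (x y : Ranking (2 * n)) (a b c : ℕ) : Prop :=
  ∀ e < 2 * n, InRegion u v x y a b c e → InBox x y a (b + 1) (c + 1) e

variable {u v : ℕ → ℝ} {x y : Ranking (2 * n)} {a b c e : ℕ}

theorem inRectangle_of_inBox {p q r : ℕ} {α β γ : ℝ} (hx : Sorts (lexKey u v) x.seq (2 * n))
    (hy : Sorts (lexKey v u) y.seq (2 * n)) (hp : p < 2 * n) (hq : q < 2 * n) (hr : r < 2 * n)
    (hα : α ≤ u p) (hβ : u q ≤ β) (hγ : v r ≤ γ) (he : e < 2 * n)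
    (h : InBox x y (x.rank p) (x.rank q + 1) (y.rank r + 1) e) : InRectangle u v α β γ e := by
  obtain ⟨hleft, hright, htop⟩ := h
  exact ⟨hα.trans (le_of_lexKey_le (Ranking.key_le hx hp he hleft)),
    (le_of_lexKey_le (Ranking.key_le hx he hq (by omega))).trans hβ,
    (le_of_lexKey_le (Ranking.key_le hy he hr (by omega))).trans hγ⟩

theorem IsStabber.inRegion_of_inBox (h : IsStabber x y a b c)
    (hx : Sorts (lexKey u v) x.seq (2 * n)) (hy : Sorts (lexKey v u) y.seq (2 * n))
    (he : e < 2 * n) (hin : InBox x y a (b + 1) (c + 1) e) : InRegion u v x y a b c e := by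
  have ha := h.left_lt
  have hb := h.right_lt
  have hc := h.top_lt
  refine inRectangle_of_inBox hx hy (x.seq_lt a ha) (x.seq_lt b hb) (y.seq_lt c hc)
    le_rfl le_rfl le_rfl he ?_
  rwa [x.rank_seq a ha, x.rank_seq b hb, y.rank_seq c hc]

-- If a point outside the rectangle in rank space ties with a point on a side, then so does the
-- next point beyond that side, since it lies between the two in the lexicographic order.
theorem IsStabber.isTight_iff (h : IsStabber x y a b c) (hx : Sorts (lexKey u v) x.seq (2 * n))
    (hy : Sorts (lexKey v u) y.seq (2 * n)) : IsTight u v x y a b c ↔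
      (1 ≤ a → ¬ InRegion u v x y a b c (x.seq (a - 1))) ∧
      (b + 1 < 2 * n → ¬ InRegion u v x y a b c (x.seq (b + 1))) ∧
      (c + 1 < 2 * n → ¬ InRegion u v x y a b c (y.seq (c + 1))) := by
  have ha := h.left_lt
  have := h.right_lt
  have hc := h.top_lt
  refine ⟨fun H => ⟨fun ha' hin => ?_, fun hb' hin => ?_, fun hc' hin => ?_⟩,
    fun ⟨hleft, hright, htop⟩ e he hin => ⟨?_, ?_, ?_⟩⟩
  · have := (H _ (x.seq_lt _ (by omega)) hin).1
    rw [x.rank_seq _ (by omega)] at this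
    omega
  · have := (H _ (x.seq_lt _ hb') hin).2.1
    rw [x.rank_seq _ hb'] at this
    omega
  · have := (H _ (y.seq_lt _ hc') hin).2.2
    rw [y.rank_seq _ hc'] at this
    omega
  · by_contra! hlt
    refine hleft (by omega) ((h.inRegion_of_inBox hx hy (x.seq_lt a ha) h.left).of_lexKey_between
      ?_ (hx.le (a - 1) a (by omega) ha) hin.1)
    exact Ranking.key_le hx he (x.seq_lt _ (by omega)) (by rw [x.rank_seq _ (by omega)]; omega)
  · by_contra! hlt
    have hb' : b + 1 < 2 * n := hlt.trans_lt (x.rank_lt e he)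
    refine hright hb' (hin.of_lexKey_between (hx.le b (b + 1) (by omega) hb') ?_ hin.2.1)
    exact Ranking.key_le hx (x.seq_lt _ hb') he (by rwa [x.rank_seq _ hb'])
  · by_contra! hlt
    have hc' : c + 1 < 2 * n := hlt.trans_lt (y.rank_lt e he)
    refine htop hc' ((h.inRegion_of_inBox hx hy (y.seq_lt c hc) h.top).of_lexKey_swap_between hin
      (hy.le c (c + 1) (by omega) hc') ?_ hin.2.2)
    exact Ranking.key_le hy (y.seq_lt _ hc') he (by rwa [y.rank_seq _ hc'])

theorem exists_isStabber (hn : 0 < n) (hx : Sorts (lexKey u v) x.seq (2 * n))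
    (hy : Sorts (lexKey v u) y.seq (2 * n)) {α β γ : ℝ}
    (hsplit : ∀ e < 2 * n, IsSplit (InRectangle u v α β γ) e) :
    ∃ a b c, IsStabber x y a b c ∧ IsTight u v x y a b c ∧
      ∀ e < 2 * n, InRectangle u v α β γ e ↔ InBox x y a (b + 1) (c + 1) e := by
  classical
  let D : Finset ℕ := {e ∈ range (2 * n) | InRectangle u v α β γ e}
  have hD {e} : e ∈ D ↔ e < 2 * n ∧ InRectangle u v α β γ e := by simp [D]
  have hne : D.Nonempty := by
    by_cases h0 : InRectangle u v α β γ 0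
    · exact ⟨0, hD.2 ⟨by omega, h0⟩⟩
    · exact ⟨mate 0, hD.2 ⟨mate_lt (by omega), not_not.1 (mt (hsplit 0 (by omega)).2 h0)⟩⟩
  obtain ⟨p, hpD, hp⟩ := D.exists_min_image x.rank hne
  obtain ⟨q, hqD, hq⟩ := D.exists_max_image x.rank hne
  obtain ⟨r, hrD, hr⟩ := D.exists_max_image y.rank hne
  obtain ⟨hp0, hpin⟩ := hD.1 hpD
  obtain ⟨hq0, hqin⟩ := hD.1 hqD
  obtain ⟨hr0, hrin⟩ := hD.1 hrD
  have hin : ∀ e < 2 * n, InRectangle u v α β γ e ↔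
      InBox x y (x.rank p) (x.rank q + 1) (y.rank r + 1) e := fun e he =>
    ⟨fun h => ⟨hp e (hD.2 ⟨he, h⟩), Nat.lt_succ_of_le (hq e (hD.2 ⟨he, h⟩)),
      Nat.lt_succ_of_le (hr e (hD.2 ⟨he, h⟩))⟩,
    inRectangle_of_inBox hx hy hp0 hq0 hr0 hpin.1 hqin.2.1 hrin.2.2 he⟩
  refine ⟨x.rank p, x.rank q, y.rank r, ⟨x.rank_lt p hp0, x.rank_lt q hq0, y.rank_lt r hr0,
    ?_, ?_, ?_, fun e he => ?_⟩, fun e he ⟨hleft, hright, htop⟩ => ?_, hin⟩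
  · rw [x.seq_rank p hp0]; exact (hin p hp0).1 hpin
  · rw [x.seq_rank q hq0]; exact (hin q hq0).1 hqin
  · rw [y.seq_rank r hr0]; exact (hin r hr0).1 hrin
  · rw [IsSplit, ← hin e he, ← hin _ (mate_lt he)]; exact hsplit e he
  · rw [x.seq_rank p hp0] at hleft
    rw [x.seq_rank q hq0] at hright
    rw [y.seq_rank r hr0] at htop
    exact (hin e he).1 ⟨hpin.1.trans hleft, hright.trans hqin.2.1, htop.trans hrin.2.2⟩

theorem endpt_two_mul {n : ℕ} (S : Fin n → Segment) (i : Fin n) :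
    endpt S ⟨2 * i, by omega⟩ = (S i).p := by
  simp [endpt]

theorem endpt_two_mul_add_one {n : ℕ} (S : Fin n → Segment) (i : Fin n) :
    endpt S ⟨2 * i + 1, by omega⟩ = (S i).q := by
  simp [endpt, Nat.add_mod, Nat.mul_add_div]

theorem mem_endpoints_iff {n : ℕ} {S : Fin n → Segment} {z : ℝ × ℝ} :
    z ∈ endpoints S ↔ ∃ e, endpt S e = z := by
  refine ⟨?_, ?_⟩
  · rintro ⟨i, rfl | rfl⟩
    exacts [⟨_, endpt_two_mul S i⟩, ⟨_, endpt_two_mul_add_one S i⟩]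
  · rintro ⟨e, rfl⟩
    refine ⟨⟨e / 2, by omega⟩, ?_⟩
    unfold endpt
    split_ifs
    exacts [.inl rfl, .inr rfl]

section

variable {n : ℕ} {S : Fin n → Segment} {u v : ℕ → ℝ} {R R' : Set (ℝ × ℝ)}

theorem stabs_iff (hS : ∀ e, endpt S e = (u e, v e)) :
    Stabs R S ↔ ∀ e < 2 * n, IsSplit (fun e => (u e, v e) ∈ R) e := by
  have hsegment (i : Fin n) : (((S i).p ∈ R ∧ (S i).q ∉ R) ∨ ((S i).p ∉ R ∧ (S i).q ∈ R)) ↔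
      IsSplit (fun e => (u e, v e) ∈ R) (2 * i) := by
    rw [← endpt_two_mul, ← endpt_two_mul_add_one, hS, hS, IsSplit,
      show mate (2 * i) = 2 * i + 1 by unfold mate; omega]
    tauto
  refine (forall_congr' hsegment).trans ⟨fun h e he => ?_, fun h i => h _ (by omega)⟩
  exact (isSplit_two_mul_half_iff _ e).1 (h ⟨e / 2, by omega⟩)

theorem combEquiv_iff (hS : ∀ e, endpt S e = (u e, v e)) :
    CombEquiv S R R' ↔ ∀ e < 2 * n, (u e, v e) ∈ R ↔ (u e, v e) ∈ R' := by
  simp only [CombEquiv, Set.ext_iff, Set.mem_inter_iff, mem_endpoints_iff, and_congr_left_iff,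
    forall_exists_index, hS, Fin.forall_iff]
  refine ⟨fun h e he => h _ e he rfl, ?_⟩
  rintro h _ e he rfl
  exact h e he

end

variable {n : ℕ} {x y : Ranking (2 * n)}

/-- The sides of a rectangle in rank space: the left and the right side are positions in the order
by abscissa, the top side is a position in the order by height. -/
structure Sides where
  left : ℕ
  right : ℕ
  top : ℕ

/-- The rectangle in rank space with the given sides is stabbing. -/
def Sides.IsStabbing (x y : Ranking (2 * n)) (s : Sides) : Prop :=
  IsStabber x y s.left s.right s.top

/-- The rectangle in rank space is stabbing, and the rectangle in the plane with the same sides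
contains the same points. -/
def Sides.IsSolution (u v : ℕ → ℝ) (x y : Ranking (2 * n)) (s : Sides) : Prop :=
  s.IsStabbing x y ∧ IsTight u v x y s.left s.right s.top

/-- The description of a 3-rectangle by the points on its sides in rank space. -/
def describe (s : Sides) (h : s.IsStabbing x y) : Description n where
  left := ⟨x.seq s.left, x.seq_lt _ h.left_lt⟩
  right := ⟨x.seq s.right, x.seq_lt _ h.right_lt⟩
  top := ⟨y.seq s.top, y.seq_lt _ h.top_lt⟩

variable {S : Fin n → Segment} {u v : ℕ → ℝ}

theorem mem_region_describe_iff (hS : ∀ e, endpt S e = (u e, v e))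
    (hx : Sorts (lexKey u v) x.seq (2 * n)) (hy : Sorts (lexKey v u) y.seq (2 * n))
    {s : Sides} (h : s.IsSolution u v x y) {e : ℕ} (he : e < 2 * n) :
    (u e, v e) ∈ (describe s h.1).region S ↔ InBox x y s.left (s.right + 1) (s.top + 1) e := by
  simp only [Description.region, describe, hS]
  exact ⟨h.2 e he, h.1.inRegion_of_inBox hx hy he⟩

theorem listsAllStabbers (hn : 0 < n) (hS : ∀ e, endpt S e = (u e, v e))
    (hx : Sorts (lexKey u v) x.seq (2 * n)) (hy : Sorts (lexKey v u) y.seq (2 * n))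
    {L : List Sides} (hL : L.Nodup) (hmem : ∀ s, s ∈ L ↔ s.IsSolution u v x y) :
    ListsAllStabbers S (L.pmap describe fun s hs => ((hmem s).1 hs).1) := by
  have hregion {s} (hs : s ∈ L) {e} (he : e < 2 * n) :=
    mem_region_describe_iff hS hx hy ((hmem s).1 hs) he
  refine ⟨fun d hd => ?_, fun d hd => ?_, ?_, ?_⟩
  · obtain ⟨s, hs, rfl⟩ := List.mem_pmap.1 hd
    have h := ((hmem s).1 hs).1
    simp only [Description.Valid, hS]
    exact ⟨(hregion hs (x.seq_lt _ h.left_lt)).2 h.left,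
      (hregion hs (x.seq_lt _ h.right_lt)).2 h.right, (hregion hs (y.seq_lt _ h.top_lt)).2 h.top⟩
  · obtain ⟨s, hs, rfl⟩ := List.mem_pmap.1 hd
    refine (stabs_iff hS).2 fun e he => ?_
    rw [IsSplit, hregion hs he, hregion hs (mate_lt he)]
    exact ((hmem s).1 hs).1.stabs e he
  · refine List.Pairwise.pmap (List.Pairwise.and_mem.1 hL) _ ?_
    rintro ⟨a, b, c⟩ h ⟨a', b', c'⟩ h' ⟨hs, hs', hne⟩ heq
    obtain ⟨rfl, rfl, rfl⟩ := h.eq_of_inBox_iff h' fun e he => by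
      rw [← hregion hs he, ← hregion hs' he]
      exact (combEquiv_iff hS).1 heq e he
    exact hne rfl
  · rintro _ ⟨α, β, γ, -, rfl⟩ hst
    obtain ⟨a, b, c, h, ht, hin⟩ := exists_isStabber hn hx hy ((stabs_iff hS).1 hst)
    have hs := (hmem ⟨a, b, c⟩).2 ⟨h, ht⟩
    refine ⟨_, List.mem_pmap.2 ⟨_, hs, rfl⟩, (combEquiv_iff hS).2 fun e he => ?_⟩
    exact (hin e he).trans (hregion hs he).symm

/-! ### The reported rectangles -/

/-- The only rectangle with left side `k` and top side `topOf x y k` that may be stabbing. -/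
def leftCandidate (x y : Ranking (2 * n)) (k : ℕ) : Sides := ⟨k, rightOf x y k, topOf x y k⟩

/-- The rectangle that is the `leftCandidate` of `k` in the reflected order of the abscissas. -/
def rightCandidate (x y : Ranking (2 * n)) (k : ℕ) : Sides :=
  ⟨2 * n - 1 - rightOf x.reverse y k, 2 * n - 1 - k, topOf x.reverse y k⟩

/-- The rectangle is stabbing and is not a `leftCandidate`. -/
def Sides.IsNewStabbing (x y : Ranking (2 * n)) (s : Sides) : Prop :=
  s.IsStabbing x y ∧ topOf x y s.left ≠ s.top

open scoped Classical in
/-- The candidates among `candidate 0, …, candidate (k - 1)` that satisfy `q` and are tight. -/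
noncomputable def reported (u v : ℕ → ℝ) (x y : Ranking (2 * n)) (q : Sides → Prop)
    (candidate : ℕ → Sides) (k : ℕ) : List Sides :=
  ((List.range k).map candidate).filter fun s => q s ∧ IsTight u v x y s.left s.right s.top

theorem mem_reported {q : Sides → Prop} {candidate : ℕ → Sides} {k : ℕ} {s : Sides} :
    s ∈ reported u v x y q candidate k ↔
      (∃ j < k, candidate j = s) ∧ q s ∧ IsTight u v x y s.left s.right s.top := by
  simp [reported]

theorem length_reported_le (u v : ℕ → ℝ) (x y : Ranking (2 * n)) (q : Sides → Prop)
    (candidate : ℕ → Sides) (k : ℕ) : (reported u v x y q candidate k).length ≤ k :=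
  (List.length_filter_le _ _).trans (by simp)

theorem nodup_reported {q : Sides → Prop} {candidate : ℕ → Sides} {k : ℕ}
    (h : ∀ i < k, ∀ j < k, candidate i = candidate j → i = j) :
    (reported u v x y q candidate k).Nodup :=
  (List.nodup_range.map_on fun i hi j hj =>
    h i (List.mem_range.1 hi) j (List.mem_range.1 hj)).filter _

/-- The output of the algorithm in rank space. -/
noncomputable def solutions (u v : ℕ → ℝ) (x y : Ranking (2 * n)) : List Sides :=
  reported u v x y (Sides.IsStabbing x y) (leftCandidate x y) (2 * n) ++
    reported u v x y (Sides.IsNewStabbing x y) (rightCandidate x y) (2 * n)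

theorem nodup_solutions (u v : ℕ → ℝ) (x y : Ranking (2 * n)) : (solutions u v x y).Nodup := by
  refine List.nodup_append'.2 ⟨nodup_reported fun i _ j _ h => congrArg Sides.left h,
    nodup_reported fun i _ j _ h => ?_, fun s hs hs' => ?_⟩
  · have := congrArg Sides.right h
    simp only [rightCandidate] at this
    omega
  · obtain ⟨⟨k, -, rfl⟩, -⟩ := mem_reported.1 hs
    exact (mem_reported.1 hs').2.1.2 rfl

theorem mem_solutions {s : Sides} : s ∈ solutions u v x y ↔ s.IsSolution u v x y := by
  rw [solutions, List.mem_append, mem_reported, mem_reported]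
  refine ⟨?_, fun ⟨h, ht⟩ => ?_⟩
  · rintro (⟨-, h, ht⟩ | ⟨-, ⟨h, -⟩, ht⟩)
    exacts [⟨h, ht⟩, ⟨h, ht⟩]
  · have ha := h.left_lt
    have hb := h.right_lt
    by_cases hc : s.top = topOf x y s.left
    · exact .inl ⟨⟨s.left, ha, by rw [leftCandidate, ← h.right_eq hc, ← hc]⟩, h, ht⟩
    · have hc' := h.top_eq.resolve_left hc
      refine .inr ⟨⟨2 * n - 1 - s.right, by omega, ?_⟩, ⟨h, Ne.symm hc⟩, ht⟩
      rw [rightCandidate, ← h.reverse.right_eq hc', ← hc', Nat.sub_sub_self (by omega),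
        Nat.sub_sub_self (by omega)]

end Plane

/-! ### The algorithm -/

namespace Reg

abbrev outLength : ℕ := 0
abbrev outLeft : ℕ := 1
abbrev outRight : ℕ := 2
abbrev outTop : ℕ := 3
abbrev outputs : List ℕ := [outLeft, outRight, outTop, outLength]
abbrev permY : ℕ := 13
abbrev rankX : ℕ := 14
abbrev rankY : ℕ := 15
abbrev reachLeft : ℕ := 16
abbrev reachAbove : ℕ := 17
abbrev topArr : ℕ := 18
abbrev rightArr : ℕ := 19
abbrev sweepLeft : ℕ := 20
abbrev sweepRight : ℕ := 21
abbrev sweepTop : ℕ := 22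
abbrev splitSegments : ℕ := 23
abbrev moved : ℕ := 24
abbrev resultArr : ℕ := 25
abbrev firstTop : ℕ := 26
abbrev firstResult : ℕ := 27

end Reg

open RealRAM.Reg Stabbing.Reg

section Preparation

/-! ### The candidate rectangles -/

/-- The maximum of two integer expressions. -/
def maxExp (e f : NExp) : NExp := .add e (.sub f e)

@[simp] theorem maxExp_eval (e f : NExp) (m : Memory) :
    (maxExp e f).eval m = max (e.eval m) (f.eval m) := by
  simp only [maxExp, NExp.eval]; omega

/-- The number of the other endpoint of a segment. -/
def mateExp (e : NExp) : NExp :=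
  .sub (.add (.mul (.const 4) (.div e (.const 2))) (.const 1)) e

@[simp] theorem mateExp_eval (e : NExp) (m : Memory) : (mateExp e).eval m = mate (e.eval m) :=
  rfl

/-- The expression `i` reflected at the middle of the positions of the endpoints. -/
def reflectExp (i : NExp) : NExp := .sub (.sub (var nPoints) (.const 1)) i

variable {n W T : ℕ} {x y z : Ranking (2 * n)} {m m' : Memory}

/-- The memory holds the number of endpoints and their rankings by abscissa and by height. -/
structure Loaded (x y : Ranking (2 * n)) (m : Memory) : Prop where
  nPoints_eq : m.nat nPoints 0 = 2 * n
  perm_eq : ∀ k < 2 * n, m.nat perm k = x.seq k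
  permY_eq : ∀ k < 2 * n, m.nat permY k = y.seq k
  rankX_eq : ∀ e < 2 * n, m.nat rankX e = x.rank e
  rankY_eq : ∀ e < 2 * n, m.nat rankY e = y.rank e

theorem Loaded.frame {l : List ℕ} (h : Loaded x y m) (hm : Frame l m m')
    (hl : ∀ a ∈ [nPoints, perm, permY, rankX, rankY], a ∉ l) : Loaded x y m' := by
  obtain ⟨hN, hx, hy, hX, hY⟩ := h
  constructor <;> rw [hm.nat _ (hl _ (by simp))] <;> assumption

/-- Store in cell `0` of the array `out` the value `reach x z 0`, which does not depend on `x`, for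
the ranks `z` in the array `src`. -/
def reachZeroProgram (src out : ℕ) : Program :=
  .seq (assign out (.const 0))
    (forLoop counter nPoints (assign out (maxExp (var out)
      (minExp (.read src (var counter)) (.read src (mateExp (var counter)))))))

/-- Extend the value `reach x z 0` in cell `0` of the array `out` to a table of `reach x z`, for the
order `x` of the points given by the expression `i` and the ranks `z` in the array `src`. -/
def reachLoop (src out : ℕ) (i : NExp) : Program :=
  forLoop counter nPoints (.store out (.add (var counter) (.const 1))
    (maxExp (.read out (var counter)) (.read src (mateExp i))))

/-- Compute a table of `reach x z` in the array `out`. -/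
def reachProgram (src out : ℕ) (i : NExp) : Program :=
  .seq (reachZeroProgram src out) (reachLoop src out i)

section

variable {src out : ℕ}

theorem Frame.nat_eq_rank (hout : out ∉ [nPoints, counter, src]) (hsrc : src ≠ counter)
    (hz : ∀ e < 2 * n, m.nat src e = z.rank e) (hm : Frame [counter, out] m m') {e : ℕ}
    (he : e < 2 * n) : m'.nat src e = z.rank e := by
  simp only [List.mem_cons, List.not_mem_nil, or_false, not_or] at hout
  rw [hm.nat src (by simp [hsrc, Ne.symm hout.2.2]), hz e he]

theorem runs_reachZeroProgram (x : Ranking (2 * n)) (hN : m.nat nPoints 0 = 2 * n)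
    (hW : 4 * n + 1 < W) (hout : out ∉ [nPoints, counter, src]) (hsrc : src ≠ counter)
    (hz : ∀ e < 2 * n, m.nat src e = z.rank e) :
    Runs W (reachZeroProgram src out) m (100 * n + 14) fun m' => m'.nat out 0 = reach x z 0 := by
  obtain ⟨hout₁, hout₂, -⟩ : out ≠ nPoints ∧ out ≠ counter ∧ out ≠ src := by
    simpa only [List.mem_cons, List.not_mem_nil, or_false, not_or] using hout
  have hm₀ : Frame [counter, out] m (m.setNat out 0 0) := .setNat _ _ _ (by simp)
  have hpoints : (m.setNat out 0 0).nat nPoints 0 = 2 * n := by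
    rw [hm₀.nat _ (by simp [Ne.symm hout₁]), hN]
  refine .assign_seq (T := 100 * n + 11) (by simp only [NExp.eval]; omega)
    ((Runs.forLoop (N := 2 * n) (T := 36)
      (fun k m' => m'.nat out 0 = (range k).sup fun e => min (z.rank e) (z.rank (mate e)))
      (by simpa [Program.writes] using Ne.symm hout₂)
      (by simpa [Program.writes] using Ne.symm hout₁) hpoints (by omega) (by simp [hout₂])
      (fun k m₁ hk hm₁ hkm hI => ?_) (by omega)).mono le_rfl fun m' _ h => ?_)
    (by simp only [NExp.cost]; omega)
  · have hrank {e} := Frame.nat_eq_rank hout hsrc hz (hm₀.trans hm₁) (e := e)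
    have hle : (range k).sup (fun e => min (z.rank e) (z.rank (mate e))) ≤ 2 * n :=
      Finset.sup_le fun e he =>
        min_le_of_left_le (z.rank_lt e ((mem_range.1 he).trans hk)).le
    have hlt := z.rank_lt k hk
    refine .of_wp trivial (by simp [Program.time, NExp.cost, maxExp, minExp, mateExp]) ?_
    simp only [Program.wp, NExp.eval, maxExp_eval, minExp_eval, mateExp_eval, hkm, hI,
      hrank hk, hrank (mate_lt hk)]
    exact ⟨by omega, by simp [hout₂, Finset.range_add_one, max_comm]⟩
  · simpa [reach] using h

theorem runs_reachLoop {i : NExp} (hN : m.nat nPoints 0 = 2 * n) (hW : 4 * n + 1 < W)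
    (hout : out ∉ [nPoints, counter, src]) (hsrc : src ≠ counter)
    (hz : ∀ e < 2 * n, m.nat src e = z.rank e) (hzero : m.nat out 0 = reach x z 0)
    (hi : ∀ k < 2 * n, ∀ m', Frame [counter, out] m m' → m'.nat counter 0 = k →
      i.eval m' = x.seq k) :
    Runs W (reachLoop src out i) m (2 * n * (2 * i.cost + 40) + 11)
      fun m' => ∀ a ≤ 2 * n, m'.nat out a = reach x z a := by
  obtain ⟨hout₁, hout₂, -⟩ : out ≠ nPoints ∧ out ≠ counter ∧ out ≠ src := by
    simpa only [List.mem_cons, List.not_mem_nil, or_false, not_or] using hout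
  refine Runs.forLoop (T := 2 * i.cost + 26) (fun k m' => ∀ a ≤ k, m'.nat out a = reach x z a)
    (by simpa [Program.writes] using Ne.symm hout₂) (by simpa [Program.writes] using Ne.symm hout₁)
    hN (by omega) (by simpa [hout₂] using hzero) (fun k m' hk hm' hkm hI => ?_) le_rfl
  have hlt : reach x z (k + 1) < 2 * n := reach_lt (by omega) hk
  refine .of_wp trivial (by simp [Program.time, NExp.cost, maxExp, mateExp]; omega) ?_
  simp only [Program.wp, NExp.eval, maxExp_eval, mateExp_eval, hkm, hi k hk m' hm' hkm,
    hI k le_rfl, Frame.nat_eq_rank hout hsrc hz hm' (mate_lt (x.seq_lt k hk)), ← reach_succ]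
  refine ⟨by omega, fun a ha => ?_⟩
  rw [Memory.nat_setNat_of_ne _ _ _ _ _ hout₂, Memory.nat_setNat_self]
  obtain rfl | hlt := Nat.eq_or_lt_of_le ha
  · rw [Function.update_self]
  · rw [Function.update_of_ne hlt.ne, hI a (by omega)]

theorem runs_reachProgram {i : NExp} (hN : m.nat nPoints 0 = 2 * n) (hW : 4 * n + 1 < W)
    (hout : out ∉ [nPoints, counter, src]) (hsrc : src ≠ counter)
    (hz : ∀ e < 2 * n, m.nat src e = z.rank e)
    (hi : ∀ k < 2 * n, ∀ m', Frame [counter, out] m m' → m'.nat counter 0 = k →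
      i.eval m' = x.seq k)
    (hT : 2 * n * (2 * i.cost + 90) + 30 ≤ T) :
    Runs W (reachProgram src out i) m T fun m' => ∀ a ≤ 2 * n, m'.nat out a = reach x z a := by
  refine (runs_reachZeroProgram x hN hW hout hsrc hz).seq
    (U := 2 * n * (2 * i.cost + 40) + 11) (fun m₁ hm₁ hzero => ?_) (by linarith)
  have hm₁ : Frame [counter, out] m m₁ :=
    hm₁.mono (by simp [reachZeroProgram, forLoop, Program.writes])
  refine runs_reachLoop ?_ hW hout hsrc (fun e he => Frame.nat_eq_rank hout hsrc hz hm₁ he) hzero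
    fun k hk m' hm' => hi k hk m' (hm₁.trans hm')
  simp only [List.mem_cons, List.not_mem_nil, or_false, not_or] at hout
  rw [hm₁.nat _ (by simp [Ne.symm hout.1]), hN]

end

/-- The arrays `topArr` and `rightArr` hold the candidate rectangles. -/
structure Prepared (x y : Ranking (2 * n)) (m : Memory) : Prop where
  topArr_eq : ∀ a ≤ 2 * n, m.nat topArr a = topOf x y a
  rightArr_eq : ∀ a < 2 * n, m.nat rightArr a = rightOf x y a

theorem Prepared.frame {l : List ℕ} (h : Prepared x y m) (hm : Frame l m m')
    (hl : ∀ a ∈ [topArr, rightArr], a ∉ l) : Prepared x y m' := by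
  obtain ⟨htop, hright⟩ := h
  constructor <;> rw [hm.nat _ (hl _ (by simp))] <;> assumption

/-- Compute the candidate rectangles. -/
def prepareProgram : Program :=
  .seq (reachProgram rankY topArr (.read perm (var counter)))
    (.seq (reachProgram rankX reachLeft (.read perm (var counter)))
      (.seq (reachProgram rankX reachAbove (.read permY (reflectExp (var counter))))
        (forLoop counter nPoints (.store rightArr (var counter)
          (maxExp (.read reachLeft (var counter))
            (.read reachAbove (reflectExp (.read topArr (var counter)))))))))

theorem runs_prepareProgram (h : Loaded x y m) (hW : 4 * n + 1 < W) :
    Runs W prepareProgram m (920 * n + 101) (Prepared x y) := by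
  refine (runs_reachProgram (x := x) (z := y) h.nPoints_eq hW (by decide) (by decide) h.rankY_eq
    (fun k hk m' hm' hkm => ?_) (T := 192 * n + 30) (by simp [NExp.cost]; omega)).seq
    (U := 720 * n + 71) (fun m₁ hm₁ htop => ?_) (by omega)
  · simp only [NExp.eval, hkm]; exact (h.frame hm' (by decide)).perm_eq k hk
  have h₁ := h.frame hm₁ (by decide)
  refine (runs_reachProgram (x := x) (z := x) h₁.nPoints_eq hW (by decide) (by decide)
    h₁.rankX_eq (fun k hk m' hm' hkm => ?_) (T := 192 * n + 30) (by simp [NExp.cost]; omega)).seq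
    (U := 520 * n + 41) (fun m₂ hm₂ hleft => ?_) (by omega)
  · simp only [NExp.eval, hkm]; exact (h₁.frame hm' (by decide)).perm_eq k hk
  have h₂ := h₁.frame hm₂ (by decide)
  refine (runs_reachProgram (x := y.reverse) (z := x) h₂.nPoints_eq hW (by decide) (by decide)
    h₂.rankX_eq (fun k hk m' hm' hkm => ?_) (T := 212 * n + 30)
    (by simp [NExp.cost, reflectExp]; omega)).seq
    (U := 300 * n + 11) (fun m₃ hm₃ habove => ?_) (by omega)
  · have hl := h₂.frame hm' (by decide)
    simp only [reflectExp, NExp.eval, hkm, hl.nPoints_eq]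
    exact hl.permY_eq _ (by omega)
  have h₃ := h₂.frame hm₃ (by decide)
  rw [← hm₂.nat _ (by decide), ← hm₃.nat _ (by decide)] at htop
  rw [← hm₃.nat _ (by decide)] at hleft
  refine (Runs.storeLoop (i := var counter) (f := rightOf x y) (g := id) (by decide) (by decide)
    h₃.nPoints_eq (by omega) Function.injective_id.injOn (fun k hk m' hm' hkm => ⟨hkm, ?_, ?_⟩)
    (by simp [NExp.cost, maxExp, reflectExp]; omega)).mono le_rfl fun m₄ hm₄ hright => ⟨?_, hright⟩
  · simp only [maxExp_eval, reflectExp, NExp.eval, hkm, (h₃.frame hm' (by decide)).nPoints_eq,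
      hm'.nat reachLeft (by decide), hm'.nat reachAbove (by decide), hm'.nat topArr (by decide),
      hleft k hk.le, htop k hk.le, habove _ ((Nat.sub_le _ _).trans (Nat.sub_le _ _))]
    rfl
  · have := rightOf_lt (x := x) (y := y) (a := k) (by omega) hk.le
    omega
  · rw [hm₄.nat _ (by decide)]
    exact htop

end Preparation

section Sweep

/-! ### Counting the split segments -/

open scoped Classical in
/-- The number of segments exactly one endpoint of which lies in the set `B`. -/
noncomputable def splitCount (n : ℕ) (B : ℕ → Prop) : ℕ :=
  #{i ∈ range n | IsSplit B (2 * i)}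

open scoped Classical in
theorem splitCount_eq_iff {n : ℕ} {B : ℕ → Prop} :
    splitCount n B = n ↔ ∀ e < 2 * n, IsSplit B e := by
  nth_rw 2 [← card_range n]
  rw [splitCount, card_filter_eq_iff]
  simp only [mem_range]
  refine ⟨fun h e he => (isSplit_two_mul_half_iff B e).1 (h (e / 2) (by omega)), fun h i hi => ?_⟩
  exact h _ (by omega)

open scoped Classical in
theorem splitCount_le {n : ℕ} {B : ℕ → Prop} : splitCount n B ≤ n :=
  (card_filter_le _ _).trans_eq (card_range n)

open scoped Classical in
theorem splitCount_pos {n e : ℕ} {B : ℕ → Prop} (he : e < 2 * n)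
    (h : IsSplit B e) : 0 < splitCount n B :=
  card_pos.2 ⟨e / 2, mem_filter.2 ⟨mem_range.2 (by omega), (isSplit_two_mul_half_iff B e).2 h⟩⟩

open scoped Classical in
theorem splitCount_add_ite {n e : ℕ} {A B : ℕ → Prop}
    (he : e < 2 * n) (hAB : ∀ f < 2 * n, f ≠ e → (A f ↔ B f)) :
    splitCount n A + (if IsSplit B e then 1 else 0) =
      splitCount n B + (if IsSplit A e then 1 else 0) := by
  have hmem : e / 2 ∈ range n := mem_range.2 (by omega)
  have hsum : ∑ i ∈ (range n).erase (e / 2), (if IsSplit A (2 * i) then 1 else 0) =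
      ∑ i ∈ (range n).erase (e / 2), (if IsSplit B (2 * i) then 1 else 0) := by
    refine sum_congr rfl fun i hi => ?_
    obtain ⟨hne, hi⟩ := mem_erase.1 hi
    have hi := mem_range.1 hi
    exact if_congr (iff_congr (hAB _ (by omega) (by omega))
      (not_congr (hAB _ (mate_lt (by omega)) (by unfold mate; omega)))) rfl rfl
  rw [splitCount, splitCount, card_filter, card_filter, ← add_sum_erase _ _ hmem,
    ← add_sum_erase _ _ hmem, hsum, if_congr (isSplit_two_mul_half_iff A e) rfl rfl,
    if_congr (isSplit_two_mul_half_iff B e) rfl rfl]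
  ring

/-! ### The sweep over all left sides -/

variable {n W : ℕ} {x y : Ranking (2 * n)} {m m' : Memory}

/-- The half-open box described by the variables `sweepLeft`, `sweepRight` and `sweepTop`. -/
def currentBox (x y : Ranking (2 * n)) (m : Memory) : ℕ → Prop :=
  InBox x y (m.nat sweepLeft 0) (m.nat sweepRight 0) (m.nat sweepTop 0)

theorem currentBox_frame {l : List ℕ} (hm : Frame l m m')
    (hl : ∀ a ∈ [sweepLeft, sweepRight, sweepTop], a ∉ l) :
    currentBox x y m' = currentBox x y m := by
  simp only [currentBox, hm.nat sweepLeft (hl _ (by simp)), hm.nat sweepRight (hl _ (by simp)),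
    hm.nat sweepTop (hl _ (by simp))]

/-- The test whether the point number `e` lies in the current box. -/
def boxTest (e : NExp) : Test :=
  .and (.natLE (var sweepLeft) (.read rankX e))
    (.and (ltTest (.read rankX e) (var sweepRight)) (ltTest (.read rankY e) (var sweepTop)))

theorem boxTest_holds {e : NExp} (h : Loaded x y m) (he : e.eval m < 2 * n) :
    (boxTest e).Holds m ↔ currentBox x y m (e.eval m) := by
  simp only [boxTest, Test.Holds, NExp.eval, h.rankX_eq _ he, h.rankY_eq _ he]
  rfl

/-- The test whether the current box contains exactly one endpoint of the segment of `e`. -/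
def splitTest (e : NExp) : Test :=
  .and (.not (.and (boxTest e) (boxTest (mateExp e))))
    (.not (.and (.not (boxTest e)) (.not (boxTest (mateExp e)))))

theorem splitTest_holds {e : NExp} (h : Loaded x y m) (he : e.eval m < 2 * n) :
    (splitTest e).Holds m ↔ IsSplit (currentBox x y m) (e.eval m) := by
  have hmate : (mateExp e).eval m < 2 * n := mate_lt he
  simp only [splitTest, Test.Holds, boxTest_holds h he, boxTest_holds h hmate, mateExp_eval,
    IsSplit]
  tauto

/-- Discount the segment of the point number `e` if the current box splits it. -/
def discount (e : NExp) : Program :=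
  .branch (splitTest e) (assign splitSegments (.sub (var splitSegments) (.const 1))) .skip

/-- Count the segment of the point number `e` if the current box splits it. -/
def recount (e : NExp) : Program :=
  .branch (splitTest e) (assign splitSegments (.add (var splitSegments) (.const 1))) .skip

open scoped Classical in
theorem runs_discount {e : NExp} (h : Loaded x y m) (he : e.eval m < 2 * n) (hW : 4 * n + 1 < W)
    (hcount : m.nat splitSegments 0 = splitCount n (currentBox x y m)) :
    Runs W (discount e) m (20 * e.cost + 140) fun m' => m'.nat splitSegments 0 +
      (if IsSplit (currentBox x y m) (e.eval m) then 1 else 0) =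
        splitCount n (currentBox x y m) := by
  have hle : splitCount n (currentBox x y m) ≤ n := splitCount_le
  refine .of_wp ⟨trivial, trivial⟩
    (by simp [discount, Program.time, NExp.cost, Test.cost, splitTest, boxTest, mateExp]; omega)
    ⟨fun hs => ?_, fun hs => ?_⟩ <;> rw [splitTest_holds h he] at hs
  · have := splitCount_pos he hs
    simp [Program.wp, NExp.eval, hcount, hs]
    omega
  · simp [Program.wp, hcount, hs]

open scoped Classical in
theorem runs_recount {e : NExp} (h : Loaded x y m) (he : e.eval m < 2 * n) (hW : 4 * n + 1 < W)
    (hcount : m.nat splitSegments 0 + (if IsSplit (currentBox x y m) (e.eval m) then 1 else 0) =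
      splitCount n (currentBox x y m)) :
    Runs W (recount e) m (20 * e.cost + 140) fun m' =>
      m'.nat splitSegments 0 = splitCount n (currentBox x y m) := by
  have hle : splitCount n (currentBox x y m) ≤ n := splitCount_le
  refine .of_wp ⟨trivial, trivial⟩
    (by simp [recount, Program.time, NExp.cost, Test.cost, splitTest, boxTest, mateExp]; omega)
    ⟨fun hs => ?_, fun hs => ?_⟩ <;> rw [splitTest_holds h he] at hs
  · simp [Program.wp, NExp.eval, ← hcount, hs] at hle ⊢
    omega
  · simpa [Program.wp, hs] using hcount

/-- Move the side `v` of the current box to the position `e` across the point number `p`, and update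
the number of split segments. -/
def moveSide (v : ℕ) (p e : NExp) : Program :=
  .seq (assign moved p)
    (.seq (discount (var moved)) (.seq (assign v e) (recount (var moved))))

theorem runs_moveSide {v w f : ℕ} {p e : NExp} (h : Loaded x y m)
    (hv : v ∈ [sweepLeft, sweepRight, sweepTop]) (hW : 4 * n + 1 < W) (hw : w < W)
    (hcount : m.nat splitSegments 0 = splitCount n (currentBox x y m))
    (hf : f < 2 * n) (hp : p.eval m = f)
    (he : ∀ m', Frame [moved, splitSegments] m m' → e.eval m' = w)
    (hbox : ∀ e < 2 * n, e ≠ f → (currentBox x y (m.setNat v 0 w) e ↔ currentBox x y m e)) :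
    Runs W (moveSide v p e) m (p.cost + e.cost + 400) fun m' => m'.nat v 0 = w ∧
      m'.nat splitSegments 0 = splitCount n (currentBox x y m') := by
  have hne : ∀ a ∈ [nPoints, perm, permY, rankX, rankY, moved, splitSegments], a ≠ v := by
    rintro a ha rfl
    revert ha
    fin_cases hv <;> decide
  have hm₁ : Frame [moved, splitSegments] m (m.setNat moved 0 f) := .setNat _ _ _ (by simp)
  rw [← currentBox_frame (x := x) (y := y) hm₁ (by decide)] at hcount
  refine .assign_seq (T := e.cost + 390) (by omega) (hp ▸ ?_) (by omega)
  refine (runs_discount (h.frame hm₁ (by decide)) (by simpa [NExp.eval] using hf) hW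
    (by simpa using hcount)).seq (U := e.cost + 190) (fun m₂ hmoved hcount₂ => ?_)
    (by simp [NExp.cost]; omega)
  have hm₂ : Frame [moved, splitSegments] (m.setNat moved 0 f) m₂ := hmoved.mono (by decide)
  have hmoved₂ : m₂.nat moved 0 = f := by rw [hmoved.nat _ (by decide)]; simp
  have hm₃ := (hm₁.trans hm₂).setNat_setNat v 0 w
  have hmoved : (m₂.setNat v 0 w).nat moved 0 = f := by
    rw [Memory.nat_setNat_of_ne _ _ _ _ _ (hne _ (by simp)), hmoved₂]
  have hload : Loaded x y (m₂.setNat v 0 w) :=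
    (h.frame (hm₁.trans hm₂) (by decide)).frame (l := [v]) (.setNat _ _ _ (by simp))
      fun a ha => by simpa using hne a (by revert ha; simp; tauto)
  have hwrite := he _ (hm₁.trans hm₂)
  refine .assign_seq (T := 180) (hwrite.trans_lt hw) (hwrite.symm ▸ ?_) (by omega)
  refine (runs_recount hload (by simpa [NExp.eval, hmoved] using hf) hW ?_).mono
    (by simp [NExp.cost]) fun m' hm' hcount' => ?_
  · have hcount₃ : (m₂.setNat v 0 w).nat splitSegments 0 = m₂.nat splitSegments 0 := by
      rw [Memory.nat_setNat_of_ne _ _ _ _ _ (hne _ (by simp))]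
    have heval : (var moved).eval (m.setNat moved 0 f) = f := by simp [NExp.eval]
    have heval₃ : (var moved).eval (m₂.setNat v 0 w) = f := hmoved
    have hbox := splitCount_add_ite hf hbox
    rw [currentBox_frame hm₁ (by decide), heval] at hcount₂
    rw [currentBox_frame hm₃ (by decide), hcount₃, heval₃]
    omega
  · have hm' : Frame [splitSegments] (m₂.setNat v 0 w) m' := hm'
    have hv' : v ∉ [splitSegments] := by simpa using (hne splitSegments (by simp)).symm
    rw [currentBox_frame hm' (by decide), hm'.nat v hv']
    exact ⟨by simp, hcount'⟩

/-- The number of moves that are left for a sweep whose current box is `[a, b) × (-∞, c)`.  The last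
two summands pay for the changes of `rightOf` from one left side to the next. -/
def sweepMeasure (x y : Ranking (2 * n)) (a b c : ℕ) : ℕ :=
  (2 * n - a) + (2 * n - c) + ((b - (rightOf x y a + 1)) + (rightOf x y a + 1 - b)) +
    (2 * n - reach x x a) + reach y.reverse x (2 * n - 1 - topOf x y a)

theorem sweepMeasure_succ_lt {a b c : ℕ} (ha : a < 2 * n) (hb : b = rightOf x y a + 1) :
    sweepMeasure x y (a + 1) b c < sweepMeasure x y a b c := by
  have hreach : reach x x a ≤ reach x x (a + 1) := reach_mono x x a.le_succ
  have hlt : reach x x (a + 1) < 2 * n := reach_lt (by omega) ha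
  have htop : topOf x y a ≤ topOf x y (a + 1) := reach_mono x y a.le_succ
  have habove : reach y.reverse x (2 * n - 1 - topOf x y (a + 1)) ≤
      reach y.reverse x (2 * n - 1 - topOf x y a) := reach_mono _ _ (by omega)
  have hright : rightOf x y a =
      max (reach x x a) (reach y.reverse x (2 * n - 1 - topOf x y a)) := rfl
  have hright' : rightOf x y (a + 1) =
      max (reach x x (a + 1)) (reach y.reverse x (2 * n - 1 - topOf x y (a + 1))) := rfl
  unfold sweepMeasure
  omega

theorem sweepMeasure_le {a b c : ℕ} (hn : 0 < n) (ha : a ≤ 2 * n) (hb : b ≤ 2 * n) :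
    sweepMeasure x y a b c ≤ 10 * n := by
  have hright : rightOf x y a < 2 * n := rightOf_lt hn ha
  have habove : reach y.reverse x (2 * n - 1 - topOf x y a) < 2 * n := reach_lt hn (by omega)
  unfold sweepMeasure
  omega

open scoped Classical in
/-- What the sweep reports about the left side `a`: the right side plus one of the candidate
rectangle with this left side if that is stabbing, and zero otherwise. -/
noncomputable def sweepResult (x y : Ranking (2 * n)) (a : ℕ) : ℕ :=
  if IsStabber x y a (rightOf x y a) (topOf x y a) then rightOf x y a + 1 else 0

/-- The invariant of the sweep: the left sides to the left of the current box are done. -/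
structure SweepInv (x y : Ranking (2 * n)) (m : Memory) : Prop where
  loaded : Loaded x y m
  prepared : Prepared x y m
  left_le : m.nat sweepLeft 0 ≤ 2 * n
  right_le : m.nat sweepRight 0 ≤ 2 * n
  top_le : m.nat sweepTop 0 ≤ topOf x y (m.nat sweepLeft 0) + 1
  count : m.nat splitSegments 0 = splitCount n (currentBox x y m)
  result : ∀ j < m.nat sweepLeft 0, m.nat resultArr j = sweepResult x y j

/-- The test whether the current box, seen as a closed rectangle, is stabbing and has a point on
each of its sides. -/
def acceptTest : Test :=
  .and (.natLE (var nPoints) (.mul (.const 2) (var splitSegments)))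
    (.and (boxTest (.read perm (var sweepLeft)))
      (.and (boxTest (.read perm (.sub (var sweepRight) (.const 1))))
        (boxTest (.read permY (.sub (var sweepTop) (.const 1))))))

theorem acceptTest_holds {a b c : ℕ} (h : SweepInv x y m) (ha : m.nat sweepLeft 0 = a)
    (hb : m.nat sweepRight 0 = b + 1) (hc : m.nat sweepTop 0 = c + 1)
    (ha' : a < 2 * n) (hb' : b < 2 * n) (hc' : c < 2 * n) :
    acceptTest.Holds m ↔ IsStabber x y a b c := by
  have hpoint {k} (hk : k < 2 * n) := h.loaded.perm_eq k hk
  have hbox : currentBox x y m = InBox x y a (b + 1) (c + 1) := by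
    simp only [currentBox, ha, hb, hc]
  have hcount : 2 * n ≤ 2 * splitCount n (InBox x y a (b + 1) (c + 1)) ↔
      ∀ e < 2 * n, IsSplit (InBox x y a (b + 1) (c + 1)) e := by
    rw [← splitCount_eq_iff]
    have := splitCount_le (n := n) (B := InBox x y a (b + 1) (c + 1))
    omega
  have hl : (NExp.read perm (var sweepLeft)).eval m = x.seq a := by
    simp only [NExp.eval, ha, hpoint ha']
  have hr : (NExp.read perm (.sub (var sweepRight) (.const 1))).eval m = x.seq b := by
    simp only [NExp.eval, hb, Nat.add_sub_cancel, hpoint hb']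
  have ht : (NExp.read permY (.sub (var sweepTop) (.const 1))).eval m = y.seq c := by
    simp only [NExp.eval, hc, Nat.add_sub_cancel, h.loaded.permY_eq c hc']
  rw [acceptTest, Test.Holds, Test.Holds, Test.Holds, Test.Holds,
    boxTest_holds h.loaded (hl ▸ x.seq_lt a ha'), boxTest_holds h.loaded (hr ▸ x.seq_lt b hb'),
    boxTest_holds h.loaded (ht ▸ y.seq_lt c hc'), hl, hr, ht]
  simp only [NExp.eval, h.loaded.nPoints_eq, h.count, hbox, hcount]
  exact ⟨fun ⟨hs, hl, hr, ht⟩ => ⟨ha', hb', hc', hl, hr, ht, hs⟩,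
    fun hs => ⟨hs.stabs, hs.left, hs.right, hs.top⟩⟩

/-- Record whether the current box is stabbing. -/
def recordResult : Program :=
  .branch acceptTest (.store resultArr (var sweepLeft) (var sweepRight))
    (.store resultArr (var sweepLeft) (.const 0))

/-- One move of the sweep. -/
def sweepStep : Program :=
  .branch (.natLE (var sweepTop) (.read topArr (var sweepLeft)))
    (moveSide sweepTop (.read permY (var sweepTop)) (.add (var sweepTop) (.const 1)))
    (.branch (.natLE (var sweepRight) (.read rightArr (var sweepLeft)))
      (moveSide sweepRight (.read perm (var sweepRight)) (.add (var sweepRight) (.const 1)))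
      (.branch (ltTest (.add (.read rightArr (var sweepLeft)) (.const 1)) (var sweepRight))
        (moveSide sweepRight (.read perm (.sub (var sweepRight) (.const 1)))
          (.sub (var sweepRight) (.const 1)))
        (.seq recordResult
          (moveSide sweepLeft (.read perm (var sweepLeft)) (.add (var sweepLeft) (.const 1))))))

/-- For each left side `a`, store `sweepResult x y a` in the array `resultArr`. -/
def sweepProgram : Program :=
  .seq prepareProgram
    (.seq (.seq (assign sweepLeft (.const 0)) (.seq (assign sweepRight (.const 0))
        (.seq (assign sweepTop (.const 0)) (assign splitSegments (.const 0)))))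
      (.loop (ltTest (var sweepLeft) (var nPoints)) sweepStep))

theorem runs_recordResult {a : ℕ} (h : SweepInv x y m) (ha : m.nat sweepLeft 0 = a)
    (hb : m.nat sweepRight 0 = rightOf x y a + 1) (hc : m.nat sweepTop 0 = topOf x y a + 1)
    (ha' : a < 2 * n) (hW : 4 * n + 1 < W) :
    Runs W recordResult m 195 fun m' => ∀ j < a + 1, m'.nat resultArr j = sweepResult x y j := by
  have hn : 0 < n := by omega
  have htest := acceptTest_holds h ha hb hc ha' (rightOf_lt hn ha'.le) (topOf_lt hn ha'.le)
  have hright := h.right_le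
  suffices H : ∀ v, v = sweepResult x y a →
      ∀ j < a + 1, (m.setNat resultArr a v).nat resultArr j = sweepResult x y j by
    refine .of_wp ⟨trivial, trivial⟩ (by decide) ⟨fun ht => ?_, fun ht => ?_⟩ <;>
      rw [htest] at ht <;> simp only [Program.wp, NExp.eval, ha, hb]
    · exact ⟨by omega, H _ (by rw [sweepResult, if_pos ht])⟩
    · exact ⟨by omega, H _ (by rw [sweepResult, if_neg ht])⟩
  rintro _ rfl j hj
  rw [Memory.nat_setNat_self]
  obtain rfl | hlt := Nat.eq_or_lt_of_le (Nat.le_of_lt_succ hj)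
  · rw [Function.update_self]
  · rw [Function.update_of_ne hlt.ne, h.result j (ha ▸ hlt)]

/-- The value of `sweepMeasure` at the current box. -/
def remainingMoves (x y : Ranking (2 * n)) (m : Memory) : ℕ :=
  sweepMeasure x y (m.nat sweepLeft 0) (m.nat sweepRight 0) (m.nat sweepTop 0)

theorem SweepInv.frame {l : List ℕ} (h : SweepInv x y m) (hm : Frame l m m')
    (hl : ∀ a ∈ [nPoints, perm, permY, rankX, rankY, topArr, rightArr, sweepLeft, resultArr], a ∉ l)
    (hright : m'.nat sweepRight 0 ≤ 2 * n)
    (htop : m'.nat sweepTop 0 ≤ topOf x y (m.nat sweepLeft 0) + 1)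
    (hcount : m'.nat splitSegments 0 = splitCount n (currentBox x y m')) : SweepInv x y m' := by
  have hleft : m'.nat sweepLeft = m.nat sweepLeft := hm.nat _ (hl _ (by simp))
  refine ⟨h.loaded.frame hm fun a ha => hl a ?_, h.prepared.frame hm fun a ha => hl a ?_,
    hleft ▸ h.left_le, hright, hleft ▸ htop, hcount, ?_⟩
  · revert ha; simp; tauto
  · revert ha; simp; tauto
  · rw [hleft, hm.nat _ (hl resultArr (by simp))]
    exact h.result

theorem runs_moveTop (h : SweepInv x y m) (ha : m.nat sweepLeft 0 < 2 * n)
    (hc : m.nat sweepTop 0 ≤ topOf x y (m.nat sweepLeft 0)) (hW : 4 * n + 1 < W) :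
    Runs W (moveSide sweepTop (.read permY (var sweepTop)) (.add (var sweepTop) (.const 1))) m 420
      fun m' => SweepInv x y m' ∧ remainingMoves x y m' < remainingMoves x y m := by
  have htop : topOf x y (m.nat sweepLeft 0) < 2 * n := topOf_lt (by omega) ha.le
  have hc' : m.nat sweepTop 0 < 2 * n := by omega
  refine (runs_moveSide (w := m.nat sweepTop 0 + 1) h.loaded (by simp) hW (by omega) h.count
    (y.seq_lt _ hc') (by simpa [NExp.eval] using h.loaded.permY_eq _ hc') (fun m' hm' => ?_)
    (fun e he hne => ?_)).mono (by simp [NExp.cost]) fun m' hm' ⟨hw, hcount⟩ =>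
      ⟨h.frame hm' (by decide) ?_ ?_ hcount, ?_⟩
  · simp only [NExp.eval, hm'.nat sweepTop (by decide)]
  · have := y.rank_ne_of_ne_seq he hne
    simp [currentBox, InBox]
    omega
  · rw [hm'.nat _ (by decide)]; exact h.right_le
  · omega
  · rw [remainingMoves, hw, hm'.nat sweepLeft (by decide), hm'.nat sweepRight (by decide),
      remainingMoves, sweepMeasure, sweepMeasure]
    omega

theorem runs_moveRight {p e : NExp} {b b' : ℕ} (h : SweepInv x y m) (hb : m.nat sweepRight 0 = b)
    (hb' : b' ≤ 2 * n) (hp : p.eval m = x.seq (min b b'))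
    (he : ∀ m', Frame [moved, splitSegments] m m' → e.eval m' = b')
    (hmove : b ≤ rightOf x y (m.nat sweepLeft 0) ∧ b' = b + 1 ∨
      rightOf x y (m.nat sweepLeft 0) + 1 < b ∧ b' + 1 = b) (hW : 4 * n + 1 < W) :
    Runs W (moveSide sweepRight p e) m (p.cost + e.cost + 400)
      fun m' => SweepInv x y m' ∧ remainingMoves x y m' < remainingMoves x y m := by
  have hle := h.right_le
  refine (runs_moveSide h.loaded (by simp) hW (by omega) h.count
    (x.seq_lt _ (by omega)) hp he (fun e he hne => ?_)).mono
    le_rfl fun m' (hm' : Frame [moved, splitSegments, sweepRight, splitSegments] m m')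
      ⟨hw, hcount⟩ => ⟨h.frame hm' (by decide) ?_ ?_ hcount, ?_⟩
  · have := x.rank_ne_of_ne_seq he hne
    simp [currentBox, InBox]
    omega
  · omega
  · rw [hm'.nat sweepTop (by decide)]; exact h.top_le
  · rw [remainingMoves, hw, hm'.nat sweepLeft (by decide), hm'.nat sweepTop (by decide),
      remainingMoves, hb, sweepMeasure, sweepMeasure]
    omega

theorem runs_nextLeft {a : ℕ} (h : SweepInv x y m) (ha : m.nat sweepLeft 0 = a)
    (hb : m.nat sweepRight 0 = rightOf x y a + 1) (hc : m.nat sweepTop 0 = topOf x y a + 1)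
    (ha' : a < 2 * n) (hW : 4 * n + 1 < W) :
    Runs W (.seq recordResult
        (moveSide sweepLeft (.read perm (var sweepLeft)) (.add (var sweepLeft) (.const 1)))) m 620
      fun m' => SweepInv x y m' ∧ remainingMoves x y m' < remainingMoves x y m := by
  refine (runs_recordResult h ha hb hc ha' hW).seq (U := 425) (fun m₁ hm₁ hresult => ?_) le_rfl
  have hm₁ : Frame [resultArr] m m₁ := hm₁.mono (by decide)
  have h₁ := h.loaded.frame hm₁ (by decide)
  rw [← hm₁.nat sweepLeft (by decide)] at ha
  refine (runs_moveSide (w := a + 1) h₁ (by simp) hW (by omega) ?_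
    (x.seq_lt a ha') ?_ (fun m' hm' => ?_) (fun e he hne => ?_)).mono
    (by simp [NExp.cost]) fun m' hm' ⟨hw, hcount⟩ => ?_
  · rw [currentBox_frame hm₁ (by decide), hm₁.nat _ (by decide)]; exact h.count
  · simp only [NExp.eval, ha, h₁.perm_eq a ha']
  · simp only [NExp.eval, hm'.nat sweepLeft (by decide), ha]
  · have := x.rank_ne_of_ne_seq he hne
    simp [currentBox, InBox, ha]
    omega
  have hright : m'.nat sweepRight = m.nat sweepRight := by
    rw [hm'.nat _ (by decide), hm₁.nat _ (by decide)]
  have htop : m'.nat sweepTop = m.nat sweepTop := by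
    rw [hm'.nat _ (by decide), hm₁.nat _ (by decide)]
  refine ⟨⟨h₁.frame hm' (by decide), (h.prepared.frame hm₁ (by decide)).frame hm' (by decide),
    by omega, hright ▸ h.right_le, ?_, hcount, ?_⟩, ?_⟩
  · rw [htop, hw, hc]
    exact Nat.succ_le_succ (reach_mono x y a.le_succ)
  · rw [hw, hm'.nat resultArr (by decide)]
    exact hresult
  · rw [remainingMoves, hw, hright, htop, remainingMoves, ← hm₁.nat sweepLeft (by decide), ha]
    exact sweepMeasure_succ_lt ha' hb

theorem runs_sweepStep (h : SweepInv x y m) (ha : m.nat sweepLeft 0 < 2 * n)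
    (hW : 4 * n + 1 < W) : Runs W sweepStep m 700
      fun m' => SweepInv x y m' ∧ remainingMoves x y m' < remainingMoves x y m := by
  have hn : 0 < n := by omega
  have hright : rightOf x y (m.nat sweepLeft 0) < 2 * n := rightOf_lt hn ha.le
  have hle := h.right_le
  have htop_le := h.top_le
  have hgoal := h.prepared.rightArr_eq _ ha
  refine .branch (T := 680) (fun htest => ?_) (fun htest => ?_) (by decide)
  · simp only [Test.Holds, NExp.eval, h.prepared.topArr_eq _ ha.le] at htest
    exact (runs_moveTop h ha htest hW).mono (by omega) fun _ _ => id
  have htop : m.nat sweepTop 0 = topOf x y (m.nat sweepLeft 0) + 1 := by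
    simp only [Test.Holds, NExp.eval, h.prepared.topArr_eq _ ha.le] at htest
    omega
  refine .branch (T := 650) (fun hlt => ?_) (fun hge => ?_) (by decide)
  · simp only [Test.Holds, NExp.eval, hgoal] at hlt
    refine (runs_moveRight (b' := m.nat sweepRight 0 + 1) h rfl (by omega) ?_
      (fun m' hm' => ?_) (by omega) hW).mono (by decide) fun _ _ => id
    · simpa [NExp.eval] using h.loaded.perm_eq _ (by omega)
    · simp only [NExp.eval, hm'.nat sweepRight (by decide)]
  refine .branch (T := 620) (fun hgt => ?_) (fun hle => ?_) (by decide)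
  · simp only [Test.Holds, NExp.eval, hgoal] at hgt
    refine (runs_moveRight (b' := m.nat sweepRight 0 - 1) h rfl (by omega) ?_
      (fun m' hm' => ?_) (by omega) hW).mono (by decide) fun _ _ => id
    · simpa [NExp.eval] using h.loaded.perm_eq _ (by omega)
    · simp only [NExp.eval, hm'.nat sweepRight (by decide)]
  · simp only [Test.Holds, NExp.eval, hgoal] at hge hle
    exact runs_nextLeft h rfl (by omega) htop ha hW

theorem SweepInv.zero (hl : Loaded x y m) (hp : Prepared x y m)
    (h : m.nat sweepLeft 0 = 0 ∧ m.nat sweepRight 0 = 0 ∧ m.nat sweepTop 0 = 0 ∧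
      m.nat splitSegments 0 = 0) : SweepInv x y m := by
  obtain ⟨ha, hb, hc, hcount⟩ := h
  refine ⟨hl, hp, by omega, by omega, by omega, ?_, fun j hj => by omega⟩
  simp [hcount, currentBox, hb, splitCount, IsSplit, InBox]

theorem runs_sweepProgram (h : Loaded x y m) (hn : 0 < n) (hW : 4 * n + 1 < W) :
    Runs W sweepProgram m (8000 * n + 200) fun m' =>
      (∀ a < 2 * n, m'.nat topArr a = topOf x y a) ∧
      ∀ a < 2 * n, m'.nat resultArr a = sweepResult x y a := by
  refine (runs_prepareProgram h hW).seq (U := 7080 * n + 40) (fun m₁ hm₁ hprep => ?_) (by omega)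
  refine Runs.seq (T := 12) (U := 7080 * n + 8) (Q := SweepInv x y)
    ((Runs.of_wp (by simp [Program.NatOnly]) (by decide) ?_).mono le_rfl fun m₂ hm₂ =>
      SweepInv.zero ((h.frame hm₁ (by decide)).frame hm₂ (by decide)) (hprep.frame hm₂ (by decide)))
    (fun m₂ _ hinv => ?_) (by omega)
  · simp [Program.wp, NExp.eval]
    omega
  have hmoves : remainingMoves x y m₂ ≤ 10 * n := sweepMeasure_le hn hinv.left_le hinv.right_le
  refine (Runs.loop (SweepInv x y) (remainingMoves x y) hinv
    (fun m' _ hI hlt => runs_sweepStep hI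
      (by simpa [Test.Holds, NExp.eval, hI.loaded.nPoints_eq] using hlt) hW)
    (by simp only [Test.cost, NExp.cost]; omega)).mono le_rfl fun m' _ ⟨hI, hdone⟩ => ?_
  have hleft : m'.nat sweepLeft 0 = 2 * n := by
    have := hI.left_le
    simp [Test.Holds, NExp.eval, hI.loaded.nPoints_eq] at hdone
    omega
  exact ⟨fun a ha => hI.prepared.topArr_eq a ha.le, hleft ▸ hI.result⟩

end Sweep

section Report

/-- Expressions for the sides of a rectangle in rank space. -/
structure SidesExp where
  left : NExp
  right : NExp
  top : NExp

/-- The values of the sides. -/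
def SidesExp.eval (m : Memory) (e : SidesExp) : Sides :=
  ⟨e.left.eval m, e.right.eval m, e.top.eval m⟩

/-- Test whether the point with the number `i` lies in the rectangle in the plane with the given
sides. -/
def regionTest (e : SidesExp) (i : NExp) : Test :=
  .and (.realLE 0 (.read perm e.left) 0 i)
    (.and (.realLE 0 i 0 (.read perm e.right)) (.realLE 1 i 1 (.read permY e.top)))

/-- Test whether none of the three points next to the sides outside the rectangle in rank space
lies in the rectangle in the plane. -/
def tightTest (e : SidesExp) : Test :=
  .and (.not (.and (.natLE (.const 1) e.left)
      (regionTest e (.read perm (.sub e.left (.const 1))))))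
    (.and
      (.not (.and (ltTest (.add e.right (.const 1)) (var nPoints))
        (regionTest e (.read perm (.add e.right (.const 1))))))
      (.not (.and (ltTest (.add e.top (.const 1)) (var nPoints))
        (regionTest e (.read permY (.add e.top (.const 1)))))))

/-- Append the rectangle with the given sides to the output if the flag `f` is nonzero and the
rectangle is tight. -/
def emit (f : NExp) (e : SidesExp) : Program :=
  .branch (.and (.natLE (.const 1) f) (tightTest e))
    (.seq (.store outLeft (var outLength) (.read perm e.left))
      (.seq (.store outRight (var outLength) (.read perm e.right))
        (.seq (.store outTop (var outLength) (.read permY e.top))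
          (assign outLength (.add (var outLength) (.const 1))))))
    .skip

variable {n W T : ℕ} {x y : Ranking (2 * n)} {m m' : Memory} {L : List Sides}

/-- The list of rectangles `L` has been output. -/
def Written (x y : Ranking (2 * n)) (L : List Sides) (m : Memory) : Prop :=
  m.nat outLength 0 = L.length ∧ ∀ (j : ℕ) (hj : j < L.length),
    m.nat outLeft j = x.seq L[j].left ∧ m.nat outRight j = x.seq L[j].right ∧
      m.nat outTop j = y.seq L[j].top

theorem Written.frame {l : List ℕ} (h : Written x y L m) (hm : Frame l m m')
    (hl : ∀ a ∈ outputs, a ∉ l) : Written x y L m' := by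
  unfold Written at h ⊢
  rwa [hm.nat _ (hl outLength (by simp)), hm.nat _ (hl outLeft (by simp)),
    hm.nat _ (hl outRight (by simp)), hm.nat _ (hl outTop (by simp))]

section

variable {s : Sides} {f : NExp} {e : SidesExp}

theorem regionTest_holds_iff (h : Loaded x y m) (hs : s.IsStabbing x y) (he : e.eval m = s)
    (i : NExp) : (regionTest e i).Holds m ↔
      InRegion (m.real 0) (m.real 1) x y s.left s.right s.top (i.eval m) := by
  rw [InRegion, ← h.perm_eq _ hs.left_lt, ← h.perm_eq _ hs.right_lt, ← h.permY_eq _ hs.top_lt,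
    ← he]
  rfl

theorem tightTest_holds_iff (h : Loaded x y m)
    (hx : Sorts (lexKey (m.real 0) (m.real 1)) x.seq (2 * n))
    (hy : Sorts (lexKey (m.real 1) (m.real 0)) y.seq (2 * n)) (hs : s.IsStabbing x y)
    (he : e.eval m = s) :
    (tightTest e).Holds m ↔ IsTight (m.real 0) (m.real 1) x y s.left s.right s.top := by
  rw [IsStabber.isTight_iff hs hx hy]
  have ha := hs.left_lt
  simp only [tightTest, Test.Holds, regionTest_holds_iff h hs he]
  subst he
  simp only [NExp.eval, h.nPoints_eq, not_and, SidesExp.eval] at ha ⊢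
  refine and_congr ?_ (and_congr (forall_congr' fun hb => ?_) (forall_congr' fun hc => ?_))
  · rw [h.perm_eq _ (by omega)]
  · rw [h.perm_eq _ hb]
  · rw [h.permY_eq _ hc]

open scoped Classical in
theorem runs_emit {p : Prop} (h : Loaded x y m)
    (hx : Sorts (lexKey (m.real 0) (m.real 1)) x.seq (2 * n))
    (hy : Sorts (lexKey (m.real 1) (m.real 0)) y.seq (2 * n)) (hW : 4 * n + 1 < W)
    (hL : Written x y L m) (hlen : L.length < 4 * n) (hp : f.eval m ≠ 0 ↔ p)
    (hs : p → s.IsStabbing x y) (he : p → ∀ m', Frame outputs m m' → e.eval m' = s)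
    (hT : (emit f e).time ≤ T) :
    Runs W (emit f e) m T (Written x y (L ++ if p ∧
        IsTight (m.real 0) (m.real 1) x y s.left s.right s.top then [s] else [])) := by
  have htest : (Test.and (.natLE (.const 1) f) (tightTest e)).Holds m ↔ p ∧
      IsTight (m.real 0) (m.real 1) x y s.left s.right s.top :=
    (and_congr_left' (Nat.one_le_iff_ne_zero.trans hp)).trans
      (and_congr_right fun hp => tightTest_holds_iff h hx hy (hs hp) (he hp m (.refl _ _)))
  refine .of_wp (by simp [emit, Program.NatOnly]) hT ?_
  simp only [emit, Program.wp, htest]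
  refine ⟨fun hf => ?_, fun hf => by simpa only [if_neg hf, List.append_nil] using hL⟩
  obtain ⟨ha, hb, hc, -⟩ := hs hf.1
  have hm₁ (i v : ℕ) : Frame outputs m (m.setNat outLeft i v) := .setNat _ _ _ (by decide)
  have hm₂ (i v j w : ℕ) : Frame outputs m ((m.setNat outLeft i v).setNat outRight j w) :=
    (hm₁ i v).trans (.setNat _ _ _ (by decide))
  have hsides {m'} (hm : Frame outputs m m') :
      (NExp.read perm e.left).eval m' = x.seq s.left ∧
        (NExp.read perm e.right).eval m' = x.seq s.right ∧
          (NExp.read permY e.top).eval m' = y.seq s.top := by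
    have h' := h.frame hm (by decide)
    rw [← h'.perm_eq _ ha, ← h'.perm_eq _ hb, ← h'.permY_eq _ hc, ← he hf.1 m' hm]
    exact ⟨rfl, rfl, rfl⟩
  simp only [hsides (.refl _ m), hsides (hm₁ _ _), hsides (hm₂ _ _ _ _), if_pos hf]
  have := x.seq_lt _ ha
  have := x.seq_lt _ hb
  have := y.seq_lt _ hc
  simp only [NExp.eval, Memory.nat_setNat_of_ne, ne_eq, not_false_eq_true,
    OfNat.zero_ne_ofNat, zero_ne_one, hL.1]
  refine ⟨by omega, by omega, by omega, by omega, by simp, fun j hj => ?_⟩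
  simp only [List.length_append, List.length_singleton] at hj
  obtain rfl | hj' := Nat.eq_or_lt_of_le (Nat.le_of_lt_succ hj)
  · simp
  · simpa [List.getElem_append_left hj', Function.update_apply, hj'.ne] using hL.2 j hj'

end

open scoped Classical in
theorem reported_succ (u v : ℕ → ℝ) (x y : Ranking (2 * n)) (q : Sides → Prop)
    (candidate : ℕ → Sides) (k : ℕ) :
    reported u v x y q candidate (k + 1) = reported u v x y q candidate k ++
      if q (candidate k) ∧ IsTight u v x y (candidate k).left (candidate k).right (candidate k).top
        then [candidate k] else [] := by
  simp [reported, List.range_succ, List.filter_append, List.filter_singleton]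

/-- Emit one rectangle for each value of the variable `counter`. -/
def reportLoop (f : NExp) (e : SidesExp) : Program := forLoop counter nPoints (emit f e)

theorem runs_reportLoop {f : NExp} {e : SidesExp} {q : Sides → Prop} {candidate : ℕ → Sides}
    (h : Loaded x y m)
    (hx : Sorts (lexKey (m.real 0) (m.real 1)) x.seq (2 * n))
    (hy : Sorts (lexKey (m.real 1) (m.real 0)) y.seq (2 * n)) (hW : 4 * n + 1 < W)
    (hL : Written x y L m) (hlen : L.length ≤ 2 * n) (hq : ∀ s, q s → s.IsStabbing x y)
    (heval : ∀ k < 2 * n, ∀ m', Frame (counter :: outputs) m m' → m'.nat counter 0 = k →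
      (f.eval m' ≠ 0 ↔ q (candidate k)) ∧ (q (candidate k) → e.eval m' = candidate k))
    (hT : 2 * n * ((emit f e).time + 14) + 11 ≤ T) :
    Runs W (reportLoop f e) m T
      (Written x y (L ++ reported (m.real 0) (m.real 1) x y q candidate (2 * n))) := by
  refine Runs.forLoop
    (fun k => Written x y (L ++ reported (m.real 0) (m.real 1) x y q candidate k))
    (by decide : counter ∉ outputs) (by decide : nPoints ∉ counter :: outputs) h.nPoints_eq
    (by omega) ?_ (fun k m₁ hk hm₁ hkm hL₁ => ?_) hT
  · have hm₀ : Frame [counter] m (m.setNat counter 0 0) := .setNat _ _ _ (by decide)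
    simpa [reported] using hL.frame hm₀ (by decide)
  · have := length_reported_le (m.real 0) (m.real 1) x y q candidate k
    refine (runs_emit (s := candidate k) (h.frame (l := counter :: outputs) hm₁ (by decide))
      (by rwa [hm₁.real]) (by rwa [hm₁.real]) hW hL₁ (by rw [List.length_append]; omega)
      (heval k hk m₁ hm₁ hkm).1 (hq _) (fun hs m₂ hm₂ => ?_) le_rfl).mono le_rfl
      fun m₂ _ hL₂ => ?_
    · exact (heval k hk m₂ (hm₁.trans (hm₂.mono (List.subset_cons_self _ _)))
        (by rw [hm₂.nat _ (by decide), hkm])).2 hs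
    · rw [reported_succ, ← List.append_assoc]
      rw [hm₁.real] at hL₂
      exact hL₂.frame (l := [counter]) (.setNat _ _ _ (by decide)) (by decide)

theorem sweepResult_ne_zero_iff {k : ℕ} :
    sweepResult x y k ≠ 0 ↔ (leftCandidate x y k).IsStabbing x y := by
  simp [sweepResult, leftCandidate, Sides.IsStabbing]

theorem sweepResult_eq {k : ℕ} (h : (leftCandidate x y k).IsStabbing x y) :
    sweepResult x y k = rightOf x y k + 1 :=
  if_pos h

theorem isStabbing_rightCandidate_iff {k : ℕ} (hk : k < 2 * n) :
    (rightCandidate x y k).IsStabbing x y ↔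
      (leftCandidate x.reverse y k).IsStabbing x.reverse y := by
  have hb := rightOf_lt (x := x.reverse) (y := y) (by omega) hk.le
  have := isStabber_reverse_iff (x := x) (y := y) (a := 2 * n - 1 - rightOf x.reverse y k)
    (b := 2 * n - 1 - k) (c := topOf x.reverse y k) (by omega) (by omega)
  rw [Nat.sub_sub_self (by omega), Nat.sub_sub_self (by omega)] at this
  exact this.symm

/-- The left candidate found for the left side `counter`. -/
def leftSides : SidesExp where
  left := var counter
  right := .sub (.read firstResult (var counter)) (.const 1)
  top := .read firstTop (var counter)

/-- The right candidate found for the left side `counter` in the reflected order. -/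
def rightSides : SidesExp where
  left := .sub (var nPoints) (.read resultArr (var counter))
  right := reflectExp (var counter)
  top := .read topArr (var counter)

/-- An expression that is nonzero if there is a right candidate for `counter` and its top side
differs from that of the left candidate with the same left side. -/
def rightFlag : NExp :=
  minExp (.read resultArr (var counter))
    (.add (.sub (.read firstTop rightSides.left) rightSides.top)
      (.sub rightSides.top (.read firstTop rightSides.left)))

/-- Report the rectangles found from the left, then those that are found only from the right. -/
def reportProgram : Program :=
  .seq (reportLoop (.read firstResult (var counter)) leftSides) (reportLoop rightFlag rightSides)

theorem eval_leftSides {k : ℕ} (hkm : m.nat counter 0 = k)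
    (htop : m.nat firstTop k = topOf x y k) (hresult : m.nat firstResult k = sweepResult x y k)
    (hs : (leftCandidate x y k).IsStabbing x y) : leftSides.eval m = leftCandidate x y k := by
  simp [leftSides, SidesExp.eval, NExp.eval, hkm, htop, hresult, sweepResult_eq hs, leftCandidate]

theorem rightFlag_ne_zero_iff {k : ℕ} (h : Loaded x y m) (hk : k < 2 * n)
    (hkm : m.nat counter 0 = k) (hfirstTop : ∀ a < 2 * n, m.nat firstTop a = topOf x y a)
    (htop : m.nat topArr k = topOf x.reverse y k)
    (hresult : m.nat resultArr k = sweepResult x.reverse y k) :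
    rightFlag.eval m ≠ 0 ↔ (rightCandidate x y k).IsNewStabbing x y := by
  rw [Sides.IsNewStabbing, isStabbing_rightCandidate_iff hk]
  simp only [rightFlag, rightSides, minExp_eval, NExp.eval, hkm, htop, hresult, h.nPoints_eq]
  by_cases hs : (leftCandidate x.reverse y k).IsStabbing x.reverse y
  · rw [hfirstTop _ (by rw [sweepResult_eq hs]; omega), sweepResult_eq hs, rightCandidate,
      Nat.sub_sub, Nat.add_comm 1]
    simp only [hs, true_and]
    omega
  · have := not_ne_iff.1 (sweepResult_ne_zero_iff.not.2 hs)
    simp [hs, this]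

theorem eval_rightSides {k : ℕ} (h : Loaded x y m) (hk : k < 2 * n) (hkm : m.nat counter 0 = k)
    (htop : m.nat topArr k = topOf x.reverse y k)
    (hresult : m.nat resultArr k = sweepResult x.reverse y k)
    (hs : (rightCandidate x y k).IsStabbing x y) : rightSides.eval m = rightCandidate x y k := by
  simp [rightSides, SidesExp.eval, NExp.eval, reflectExp, hkm, htop, hresult, h.nPoints_eq,
    sweepResult_eq ((isStabbing_rightCandidate_iff hk).1 hs), rightCandidate]
  omega

theorem runs_reportProgram (h : Loaded x y m)
    (hx : Sorts (lexKey (m.real 0) (m.real 1)) x.seq (2 * n))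
    (hy : Sorts (lexKey (m.real 1) (m.real 0)) y.seq (2 * n)) (hW : 4 * n + 1 < W)
    (hlength : m.nat outLength 0 = 0)
    (hfirstTop : ∀ a < 2 * n, m.nat firstTop a = topOf x y a)
    (hfirstResult : ∀ a < 2 * n, m.nat firstResult a = sweepResult x y a)
    (htop : ∀ a < 2 * n, m.nat topArr a = topOf x.reverse y a)
    (hresult : ∀ a < 2 * n, m.nat resultArr a = sweepResult x.reverse y a) :
    Runs W reportProgram m (1100 * n + 100)
      (Written x y (solutions (m.real 0) (m.real 1) x y)) := by
  refine (runs_reportLoop (L := []) (candidate := leftCandidate x y) h hx hy hW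
    ⟨hlength, by simp⟩ (by simp) (fun _ hs => hs) (fun k hk m₁ hm₁ hkm => ?_)
    (T := 500 * n + 50) ?_).seq (U := 600 * n + 50) (fun m₁ hm₁ hL => ?_) (by omega)
  · rw [← hm₁.nat _ (by decide)] at hfirstTop hfirstResult
    refine ⟨?_, eval_leftSides hkm (hfirstTop k hk) (hfirstResult k hk)⟩
    simp only [NExp.eval, hkm, hfirstResult k hk]
    exact sweepResult_ne_zero_iff
  · have : (emit (.read firstResult (var counter)) leftSides).time ≤ 200 := by decide
    nlinarith
  · have hm₁ : Frame (counter :: outputs) m m₁ := hm₁.mono (by decide)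
    rw [solutions, ← hm₁.real]
    rw [← hm₁.real] at hx hy
    rw [List.nil_append, ← hm₁.real] at hL
    refine runs_reportLoop (h.frame hm₁ (by decide)) hx hy hW hL
      (length_reported_le _ _ _ _ _ _ _) (fun _ hs => hs.1) (fun k hk m₂ hm₂ hkm => ?_) ?_
    · have hm₂ := hm₁.trans hm₂
      rw [← hm₂.nat _ (by decide)] at hfirstTop htop hresult
      have h₂ := h.frame hm₂ (by decide)
      exact ⟨rightFlag_ne_zero_iff h₂ hk hkm hfirstTop (htop k hk) (hresult k hk),
        fun hs => eval_rightSides h₂ hk hkm (htop k hk) (hresult k hk) hs.1⟩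
    · have : (emit rightFlag rightSides).time ≤ 280 := by decide
      nlinarith

end Report

section Algorithm

variable {n N W : ℕ} {x y : Ranking (2 * n)} {m : Memory}

/-- Copy the array `src` to the array `dst`. -/
def copyLoop (dst src : ℕ) : Program :=
  forLoop counter nPoints (.store dst (var counter) (.read src (var counter)))

/-- Store the inverse of the permutation `perm` in the array `dst`. -/
def invertLoop (dst : ℕ) : Program :=
  forLoop counter nPoints (.store dst (.read perm (var counter)) (var counter))

theorem writes_invertLoop (dst : ℕ) : (invertLoop dst).writes = [counter, dst, counter] := rfl

theorem runs_copyLoop {dst src : ℕ} {f : ℕ → ℕ} (hN : m.nat nPoints 0 = N) (hW : N < W)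
    (hdst : dst ∉ [nPoints, counter, src]) (hsrc : src ≠ counter)
    (hf : ∀ k < N, m.nat src k = f k) (hfW : ∀ k < N, f k < W) :
    Runs W (copyLoop dst src) m (20 * N + 11) fun m' => ∀ k < N, m'.nat dst k = f k := by
  simp only [List.mem_cons, List.not_mem_nil, or_false, not_or] at hdst
  obtain ⟨hdst₁, hdst₂, hdst₃⟩ := hdst
  refine Runs.storeLoop (g := id) (Ne.symm hdst₂) (by simpa using Ne.symm hdst₁) hN hW
    Function.injective_id.injOn (fun k hk m' hm' hkm => ⟨hkm, ?_, hfW k hk⟩)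
    (by simp [NExp.cost]; omega)
  rw [← hf k hk, ← hm'.nat src (by simp [hsrc, Ne.symm hdst₃]), ← hkm]
  rfl

theorem runs_invertLoop {dst : ℕ} {z : Ranking N} (hN : m.nat nPoints 0 = N) (hW : N < W)
    (hdst : dst ∉ [nPoints, counter, perm]) (hz : ∀ k < N, m.nat perm k = z.seq k) :
    Runs W (invertLoop dst) m (20 * N + 11) fun m' => ∀ e < N, m'.nat dst e = z.rank e := by
  simp only [List.mem_cons, List.not_mem_nil, or_false, not_or] at hdst
  obtain ⟨hdst₁, hdst₂, hdst₃⟩ := hdst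
  have hinj : Set.InjOn z.seq (Set.Iio N) := fun i hi j hj hij => by
    rw [← z.rank_seq i hi, hij, z.rank_seq j hj]
  refine (Runs.storeLoop (i := .read perm (var counter)) (e := var counter) (f := id)
    (Ne.symm hdst₂) (by simpa using Ne.symm hdst₁) hN hW hinj
    (fun k hk m' hm' hkm => ⟨?_, hkm, hk.trans hW⟩) (by simp [NExp.cost]; omega)).mono le_rfl
    fun m' _ h e he => ?_
  · rw [← hz k hk, ← hm'.nat perm (by simp [Ne.symm hdst₃]), ← hkm]
    rfl
  · simpa only [id, z.seq_rank e he] using h _ (z.rank_lt e he)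

theorem writes_sortProgram (a b : ℕ) : (sortProgram a b).writes = (sortProgram 0 0).writes := rfl

/-- Sort the points by the real array `a`, with ties broken by the real array `b`, and store their
ranks in the array `dst`. -/
def orderProgram (a b dst : ℕ) : Program := .seq (sortProgram a b) (invertLoop dst)

theorem runs_orderProgram {a b dst : ℕ} (hN : m.nat nPoints 0 = N) (hW : 2 * N + 1 < W)
    (hdst : dst ∉ [nPoints, counter, perm]) :
    Runs W (orderProgram a b dst) m (300 * (N + 1) * (Nat.clog 2 N + 1) + 20 * N + 11) fun m' =>
      ∃ z : Ranking N, Sorts (lexKey (m.real a) (m.real b)) z.seq N ∧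
        (∀ k < N, m'.nat perm k = z.seq k) ∧ ∀ e < N, m'.nat dst e = z.rank e := by
  refine (runs_sortProgram hN hW).seq (U := 20 * N + 11) (fun m₁ hm₁ hsorts => ?_) (by omega)
  have hN₁ : m₁.nat nPoints 0 = N := by rw [hm₁.nat _ (by rw [writes_sortProgram]; decide), hN]
  refine (runs_invertLoop (z := rankingOfSorts hsorts) hN₁ (by omega) hdst fun _ _ => rfl).mono
    le_rfl fun m₂ hm₂ hrank => ⟨_, hsorts, fun k _ => ?_, hrank⟩
  rw [hm₂.nat perm (by rw [writes_invertLoop]; simp_all [eq_comm])]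
  rfl

/-- Sort the points in both directions. -/
def rankProgram : Program :=
  .seq (.seq (assign nPoints (.mul (.const 2) (var outLength))) (assign outLength (.const 0)))
    (.seq (orderProgram 1 0 rankY) (.seq (copyLoop permY perm) (orderProgram 0 1 rankX)))

theorem runs_rankProgram (hn : m.nat outLength 0 = n) (hW : 4 * n + 1 < W) :
    Runs W rankProgram m (600 * (2 * n + 1) * (Nat.clog 2 (2 * n) + 1) + 120 * n + 50) fun m' =>
      m'.nat outLength 0 = 0 ∧ ∃ x y : Ranking (2 * n), Loaded x y m' ∧
        Sorts (lexKey (m.real 0) (m.real 1)) x.seq (2 * n) ∧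
        Sorts (lexKey (m.real 1) (m.real 0)) y.seq (2 * n) := by
  set K := 300 * (2 * n + 1) * (Nat.clog 2 (2 * n) + 1) with hK
  refine Runs.seq (T := 12) (U := 2 * K + 120 * n + 35)
    (Q := fun m' => m'.nat nPoints 0 = 2 * n ∧ m'.nat outLength 0 = 0)
    (.of_wp (by simp [Program.NatOnly]) (by decide)
      (by simp [Program.wp, NExp.eval, hn]; omega)) (fun m₁ hm₁ ⟨hN₁, h0⟩ => ?_)
    (by rw [hK]; linarith)
  refine (runs_orderProgram hN₁ (by omega) (by decide)).seq (U := K + 80 * n + 22)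
    (fun m₂ hm₂ ⟨y, hy, hperm₂, hrankY⟩ => ?_) (by omega)
  have hN₂ : m₂.nat nPoints 0 = 2 * n := by rw [hm₂.nat _ (by decide), hN₁]
  refine (runs_copyLoop hN₂ (by omega) (by decide) (by decide) hperm₂
    fun k hk => (y.seq_lt k hk).trans (by omega)).seq (U := K + 40 * n + 11)
    (fun m₃ hm₃ hpermY => ?_) (by omega)
  have hN₃ : m₃.nat nPoints 0 = 2 * n := by rw [hm₃.nat _ (by decide), hN₂]
  refine (runs_orderProgram hN₃ (by omega) (by decide)).mono (by omega)
    fun m₄ hm₄ ⟨x, hx, hperm₄, hrankX⟩ => ⟨?_, x, y, ⟨?_, hperm₄, ?_, hrankX, ?_⟩, ?_, ?_⟩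
  · rw [hm₄.nat _ (by decide), hm₃.nat _ (by decide), hm₂.nat _ (by decide), h0]
  · rw [hm₄.nat _ (by decide), hN₃]
  · rwa [hm₄.nat _ (by decide)]
  · rwa [hm₄.nat _ (by decide), hm₃.nat _ (by decide)]
  · rwa [hm₃.real, hm₂.real, hm₁.real] at hx
  · rwa [hm₁.real] at hy

/-- Reflect the order of the points by abscissa. -/
def reflectProgram : Program :=
  .seq (forLoop counter nPoints
      (.store permTmp (var counter) (.read perm (reflectExp (var counter)))))
    (.seq (copyLoop perm permTmp) (invertLoop rankX))

theorem runs_reflectProgram (h : Loaded x y m) (hW : 4 * n + 1 < W) :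
    Runs W reflectProgram m (140 * n + 33) (Loaded x.reverse y) := by
  refine (Runs.storeLoop (i := var counter) (e := .read perm (reflectExp (var counter)))
    (f := x.reverse.seq) (g := id) (by decide) (by decide) h.nPoints_eq
    (by omega) Function.injective_id.injOn (fun k hk m' hm' hkm => ⟨hkm, ?_, ?_⟩)
    (T := 60 * n + 11) (by simp [NExp.cost, reflectExp]; omega)).seq (U := 80 * n + 22)
    (fun m₁ hm₁ htmp => ?_) (by omega)
  · have h' := h.frame hm' (by decide)
    simp only [NExp.eval, reflectExp, hkm, h'.nPoints_eq]
    exact h'.perm_eq _ (by omega)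
  · exact (x.reverse.seq_lt k hk).trans (by omega)
  have h₁ := h.frame hm₁ (by decide)
  refine (runs_copyLoop h₁.nPoints_eq (by omega) (by decide) (by decide) htmp
    fun k hk => (x.reverse.seq_lt k hk).trans (by omega)).seq (U := 40 * n + 11)
    (fun m₂ hm₂ hperm => ?_) (by omega)
  have hN₂ : m₂.nat nPoints 0 = 2 * n := by rw [hm₂.nat _ (by decide), h₁.nPoints_eq]
  refine (runs_invertLoop hN₂ (by omega) (by decide) hperm).mono (by omega)
    fun m₃ hm₃ hrankX => ⟨?_, ?_, ?_, hrankX, ?_⟩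
  · rw [hm₃.nat _ (by decide), hN₂]
  · rwa [hm₃.nat _ (by decide)]
  · rw [hm₃.nat _ (by decide), hm₂.nat _ (by decide)]
    exact h₁.permY_eq
  · rw [hm₃.nat _ (by decide), hm₂.nat _ (by decide)]
    exact h₁.rankY_eq

theorem Loaded.of_reverse_reverse (h : Loaded x.reverse.reverse y m) : Loaded x y m := by
  refine ⟨h.nPoints_eq, fun k hk => ?_, h.permY_eq, fun e he => ?_, h.rankY_eq⟩
  · rw [h.perm_eq k hk]
    change x.seq (2 * n - 1 - (2 * n - 1 - k)) = x.seq k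
    rw [Nat.sub_sub_self (by omega)]
  · have := x.rank_lt e he
    rw [h.rankX_eq e he]
    change 2 * n - 1 - (2 * n - 1 - x.rank e) = x.rank e
    omega

/-- Save the results of a sweep. -/
def saveProgram : Program := .seq (copyLoop firstTop topArr) (copyLoop firstResult resultArr)

theorem runs_saveProgram {t r : ℕ → ℕ} (hN : m.nat nPoints 0 = N) (hW : N < W)
    (htop : ∀ k < N, m.nat topArr k = t k) (hresult : ∀ k < N, m.nat resultArr k = r k)
    (ht : ∀ k < N, t k < W) (hr : ∀ k < N, r k < W) :
    Runs W saveProgram m (40 * N + 22) fun m' =>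
      (∀ k < N, m'.nat firstTop k = t k) ∧ ∀ k < N, m'.nat firstResult k = r k := by
  refine (runs_copyLoop hN hW (by decide) (by decide) htop ht).seq (U := 20 * N + 11)
    (fun m₁ hm₁ hfirst => ?_) (by omega)
  refine (runs_copyLoop (by rw [hm₁.nat _ (by decide), hN]) hW (by decide) (by decide)
    (by rwa [hm₁.nat _ (by decide)]) hr).mono le_rfl fun m₂ hm₂ hsecond => ⟨?_, hsecond⟩
  rwa [hm₂.nat _ (by decide)]

/-- Report all combinatorially different stabbing 3-rectangles. -/
def stabbingProgram : Program :=
  .seq rankProgram (.seq sweepProgram (.seq saveProgram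
    (.seq reflectProgram (.seq sweepProgram (.seq reflectProgram reportProgram)))))

/-- The running time of `stabbingProgram`. -/
def runningTime (n : ℕ) : ℕ := 20000 * (n + 1) * (Nat.clog 2 (2 * n) + 1)

theorem sweepResult_lt (hn : 0 < n) {k : ℕ} (hk : k ≤ 2 * n) : sweepResult x y k < 2 * n + 1 := by
  have := rightOf_lt (x := x) (y := y) hn hk
  unfold sweepResult
  split_ifs <;> omega

theorem runs_stabbingProgram (hn : 0 < n) (hm : m.nat outLength 0 = n) (hW : 4 * n + 1 < W) :
    Runs W stabbingProgram m (runningTime n) fun m' => ∃ x y : Ranking (2 * n),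
      Sorts (lexKey (m.real 0) (m.real 1)) x.seq (2 * n) ∧
      Sorts (lexKey (m.real 1) (m.real 0)) y.seq (2 * n) ∧
      Written x y (solutions (m.real 0) (m.real 1) x y) m' := by
  refine (runs_rankProgram hm hW).seq (U := 17580 * n + 600)
    (fun m₁ hm₁ ⟨h0, x, y, h₁, hx, hy⟩ => ?_)
    (by unfold runningTime; nlinarith [Nat.zero_le (n * Nat.clog 2 (2 * n))])
  refine (runs_sweepProgram h₁ hn hW).seq (U := 9580 * n + 400)
    (fun m₂ hm₂ ⟨htop, hresult⟩ => ?_) (by omega)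
  have h₂ := h₁.frame hm₂ (by decide)
  refine (runs_saveProgram h₂.nPoints_eq (by omega) htop hresult
    (fun k hk => (topOf_lt hn hk.le).trans (by omega))
    fun k hk => (sweepResult_lt hn hk.le).trans (by omega)).seq (U := 9500 * n + 370)
    (fun m₃ hm₃ ⟨hfirstTop, hfirstResult⟩ => ?_) (by omega)
  refine (runs_reflectProgram (h₂.frame hm₃ (by decide)) hW).seq (U := 9360 * n + 335)
    (fun m₄ hm₄ h₄ => ?_) (by omega)
  refine (runs_sweepProgram h₄ hn hW).seq (U := 1300 * n + 135)
    (fun m₅ hm₅ ⟨htop', hresult'⟩ => ?_) (by omega)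
  refine (runs_reflectProgram (h₄.frame hm₅ (by decide)) hW).seq (U := 1100 * n + 100)
    (fun m₆ hm₆ h₆ => ?_) (by omega)
  have hreal : m₆.real = m.real := by
    rw [hm₆.real, hm₅.real, hm₄.real, hm₃.real, hm₂.real, hm₁.real]
  refine (runs_reportProgram h₆.of_reverse_reverse (hreal ▸ hx) (hreal ▸ hy) hW ?_ ?_ ?_ ?_
    ?_).mono le_rfl fun m₇ _ h => ⟨x, y, hx, hy, hreal ▸ h⟩
  · rw [hm₆.nat _ (by decide), hm₅.nat _ (by decide), hm₄.nat _ (by decide),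
      hm₃.nat _ (by decide), hm₂.nat _ (by decide), h0]
  · rwa [hm₆.nat _ (by decide), hm₅.nat _ (by decide), hm₄.nat _ (by decide)]
  · rwa [hm₆.nat _ (by decide), hm₅.nat _ (by decide), hm₄.nat _ (by decide)]
  · rwa [hm₆.nat _ (by decide)]
  · rwa [hm₆.nat _ (by decide)]

theorem clog_two_mul_add_one_le {n : ℕ} (hn : 2 ≤ n) :
    (Nat.clog 2 (2 * n) : ℝ) + 1 ≤ 8 * Real.log n := by
  have hclog : Nat.clog 2 (2 * n) ≤ Nat.log 2 n + 2 := by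
    refine Nat.clog_le_of_le_pow ?_
    have := Nat.lt_pow_succ_log_self one_lt_two n
    rw [pow_succ]
    omega
  have hlog : (Nat.log 2 n : ℝ) * Real.log 2 ≤ Real.log n := by
    rw [← Real.log_pow]
    exact Real.log_le_log (by positivity) (by exact_mod_cast Nat.pow_log_le_self 2 (by omega))
  have hlog2 : Real.log 2 ≤ Real.log n := Real.log_le_log two_pos (by exact_mod_cast hn)
  have hclog' : (Nat.clog 2 (2 * n) : ℝ) ≤ Nat.log 2 n + 2 := by exact_mod_cast hclog
  nlinarith [Real.log_two_gt_d9, (Nat.log 2 n).cast_nonneg (α := ℝ)]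

theorem runningTime_isBigO : Asymptotics.IsBigO Filter.atTop (fun n : ℕ => (runningTime n : ℝ))
    (fun n : ℕ => (n : ℝ) * Real.log (n : ℝ)) := by
  refine Asymptotics.IsBigO.of_bound 320000 (Filter.eventually_atTop.2 ⟨2, fun n hn => ?_⟩)
  have hn' : (2 : ℝ) ≤ n := by exact_mod_cast hn
  have : 0 ≤ Real.log n := Real.log_nonneg (by linarith)
  rw [Real.norm_of_nonneg (by positivity), Real.norm_of_nonneg (by positivity), runningTime]
  push_cast
  calc 20000 * ((n : ℝ) + 1) * ((Nat.clog 2 (2 * n) : ℝ) + 1)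
      ≤ 20000 * (2 * n) * (8 * Real.log n) := by
        gcongr
        · linarith
        · exact clog_two_mul_add_one_le hn
    _ = 320000 * (n * Real.log n) := by ring

theorem four_mul_add_one_lt_pow {n : ℕ} (hn : 1 ≤ n) : 4 * n + 1 < (n + 1) ^ 3 := by
  nlinarith [Nat.zero_le (n ^ 3), Nat.pow_le_pow_left hn 2, Nat.pow_le_pow_left hn 3]

theorem Written.outputs {L : List Sides} (h : Written x y L m)
    (hL : ∀ s ∈ L, s.IsStabbing x y) : Outputs m (L.pmap describe hL) := by
  refine ⟨by rw [List.length_pmap]; exact h.1, fun j hj => ?_⟩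
  rw [List.getElem_pmap]
  exact h.2 j (by simpa using hj)

end Algorithm

end Stabbing

/-- One fixed program, run with words of `O(log n)` bits, reports all combinatorially different
stabbing 3-rectangles of any `n ≥ 1` segments in worst-case time `O(n log n)`. -/
theorem mainTheorem1 :
    ∃ (prog : RealRAM.Program) (k : ℕ) (T : ℕ → ℕ),
      Asymptotics.IsBigO Filter.atTop (fun n : ℕ => (T n : ℝ))
        (fun n : ℕ => (n : ℝ) * Real.log (n : ℝ)) ∧
      ∀ n : ℕ, 1 ≤ n → ∀ S : Fin n → Stabbing.Segment,
        ∃ (m : RealRAM.Memory) (t : ℕ) (L : List (Stabbing.Description n)),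
          RealRAM.Exec ((n + 1) ^ k) prog (Stabbing.initialMemory S) m t ∧ t ≤ T n ∧
          Stabbing.Outputs m L ∧ Stabbing.ListsAllStabbers S L := by
  refine ⟨Stabbing.stabbingProgram, 3, Stabbing.runningTime, Stabbing.runningTime_isBigO,
    fun n hn S => ?_⟩
  obtain ⟨m, t, hexec, ht, -, x, y, hx, hy, hwritten⟩ := Stabbing.runs_stabbingProgram hn
    (m := Stabbing.initialMemory S) (by simp [Stabbing.initialMemory])
    (Stabbing.four_mul_add_one_lt_pow hn)
  exact ⟨m, t, _, hexec, ht, hwritten.outputs fun s hs => (Stabbing.mem_solutions.1 hs).1,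
    Stabbing.listsAllStabbers hn (fun e => by simp [Stabbing.initialMemory]) hx hy
      (Stabbing.nodup_solutions _ _ x y) fun s => Stabbing.mem_solutions⟩
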